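/- A \emph{lattice graph} is a finite, non-empty oriented graph $\Lambda=(\Lambda^0,\Lambda^1)$ with source and target maps $s,t\colon\Lambda^1\to\Lambda^0$, with at most one edge between any two vertices, without loops, and connected as an unoriented graph. Let $\mathsf C_\Lambda$ be the category of oriented paths in $\Lambda$. A \emph{refinement} $\iota\colon\Lambda_i\to\Lambda_j$ is a functor $\mathsf C_{\Lambda_i}\to\mathsf C_{\Lambda_j}$ that is injective on vertices, maps every edge to a path of positive length, and maps distinct edges to paths without common edges. Lattice graphs and refinements form a category. Let $G$ be a compact Hausdorff topological group (for example a compact Lie group), let $I$ be a non-empty directed set, and let $(\Lambda_i,\iota_{i,j})_{i\le j\in I}$ be a direct system of lattice graphs and refinements. Put $X_i=G^{\Lambda_i^1}$ with its normalized Haar measure $\mu_i$, and for $i\le j$ let $R_{i,j}\colon X_j\to X_i$, $R_{i,j}(a)_e=a_{e_1}\cdots a_{e_n}$, where $\iota_{i,j}(e)=(e_1,\dots,e_n)$. The gauge group $\mathcal G_i=G^{\Lambda_i^0}$ acts on $X_i$ by $(g\cdot a)_e=g_{s(e)}a_eg_{t(e)}^{-1}$. Let $X_i^{\rm red}=\mathcal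 G_i\backslash X_i$ be the compact Hausdorff quotient with the image $\mu_i^{\rm red}$ of $\mu_i$ and the induced maps $R_{i,j}^{\rm red}$. The maps $R_{i,j}$ and $R^{\rm red}_{i,j}$ preserve the measures, so that $u_{i,j}\psi=\psi\circ R_{i,j}$ is an isometry of $L^2(X_i,\mu_i)$ into $L^2(X_j,\mu_j)$, and the algebras of compact operators $B_0(L^2(X_i,\mu_i))$ form a direct system of C*-algebras with the connecting maps $b\mapsto u_{i,j}\,b\,u_{i,j}^*$; likewise in the reduced case. Let $(X_i,\mu_i,R_{i,j})$ stand either for this system or for the reduced system $(X_i^{\rm red},\mu_i^{\rm red},R_{i,j}^{\rm red})$. Let $X_\infty=\varprojlim X_i$ be the inverse limit of topological spaces, with projections $R_{i,\infty}\colon X_\infty\to X_i$, and let $A_\infty=\varinjlim B_0(L^2(X_i,\mu_i))$ be the direct limit of C*-algebras. Then there is exactly one Radon measure $\mu$ on $X_\infty$ with $(R_{i,\infty})_*\mu=\mu_i$ for all $i$; it has full support. The (full) groupoid C*-algebra $C^*(X_\infty\times X_\infty)$ of the pair groupoid of $X_\infty$ with the Haar system $\{\mu\times\delta_x\}_{x\in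 X_\infty}$, that is, the enveloping C*-algebra of $C(X_\infty\times X_\infty)$ with product $(\phi_1*\phi_2)(x_1,x_2)=\int\phi_1(y,x_2)\phi_2(x_1,y)\,d\mu(y)$ and involution $\phi^*(x_1,x_2)=\overline{\phi(x_2,x_1)}$, is isomorphic to $A_\infty$, which in turn is isomorphic to $B_0(L^2(X_\infty,\mu))$: $$C^*(X_\infty\times X_\infty)\;\cong\;A_\infty\;\cong\;B_0(L^2(X_\infty,\mu)).$$ The isomorphisms $\Phi\colon C^*(X_\infty\times X_\infty)\to A_\infty$ and $\Psi\colon A_\infty\to B_0(L^2(X_\infty,\mu))$ can be chosen such that $\Psi\circ\Phi$ maps $h\in C(X_\infty\times X_\infty)$ to the integral operator $(T_h\psi)(x)=\int h(y,x)\psi(y)\,d\mu(y)$, and $\Psi$ maps the image in $A_\infty$ of $b\in B_0(L^2(X_i,\mu_i))$ to $u_{i,\infty}\,b\,u_{i,\infty}^*$, where $u_{i,\infty}\psi=\psi\circ R_{i,\infty}$. -/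

import Mathlib

open CategoryTheory MeasureTheory TopologicalSpace
open scoped ENNReal

universe u v w

noncomputable section

/-! ### Oriented graphs and their refinements -/

/-- A finite oriented graph with at most one edge between any two vertices, without loops, and
connected as an unoriented graph. -/
structure LatticeGraph : Type (u + 1) where
  V : Type u
  E : Type u
  [finite_V : Finite V]
  [finite_E : Finite E]
  src : E → V
  tgt : E → V
  edge_unique : ∀ e e' : E,
    (src e = src e' ∧ tgt e = tgt e') ∨ (src e = tgt e' ∧ tgt e = src e') → e = e'
  src_ne_tgt : ∀ e : E, src e ≠ tgt e
  [nonempty_V : Nonempty V]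
  connected : ∀ x y : V, Relation.EqvGen (fun x y => ∃ e : E, src e = x ∧ tgt e = y) x y

namespace LatticeGraph

attribute [instance] finite_V finite_E nonempty_V

instance (Λ : LatticeGraph.{u}) : Quiver.{u} Λ.V where
  Hom x y := {e : Λ.E // Λ.src e = x ∧ Λ.tgt e = y}

/-- An edge, as an arrow of the underlying quiver. -/
def arrow (Λ : LatticeGraph.{u}) (e : Λ.E) : Λ.src e ⟶ Λ.tgt e := ⟨e, rfl, rfl⟩

/-- The edge `d` is one of the edges of the path `p`. -/
def Occurs {Λ : LatticeGraph.{u}} (d : Λ.E) {x : Λ.V} : ∀ {y : Λ.V}, Quiver.Path x y → Prop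
  | _, .nil => False
  | _, .cons p e => Occurs d p ∨ e.1 = d

/-- The path category generated by a graph. -/
abbrev PathCat (Λ : LatticeGraph.{u}) : Type u := Paths Λ.V

/-- The map on vertices underlying a functor between path categories. -/
def mapVertex {Λ Λ' : LatticeGraph.{u}} (F : Λ.PathCat ⥤ Λ'.PathCat) (x : Λ.V) : Λ'.V :=
  F.obj x

/-- A functor between path categories, applied to a path. -/
def mapPath {Λ Λ' : LatticeGraph.{u}} (F : Λ.PathCat ⥤ Λ'.PathCat) {x y : Λ.V}
    (p : Quiver.Path x y) : Quiver.Path (mapVertex F x) (mapVertex F y) :=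
  F.map (X := x) (Y := y) p

/-- The image of an edge under a functor between path categories, as a path. -/
def edgeImage {Λ Λ' : LatticeGraph.{u}} (F : Λ.PathCat ⥤ Λ'.PathCat) (e : Λ.E) :
    Quiver.Path (mapVertex F (Λ.src e)) (mapVertex F (Λ.tgt e)) :=
  mapPath F (Λ.arrow e).toPath

/-- The conditions on a functor between path categories that make it a refinement. -/
structure IsRefinement {Λ Λ' : LatticeGraph.{u}} (F : Λ.PathCat ⥤ Λ'.PathCat) : Prop where
  obj_injective : Function.Injective (mapVertex F)
  nontrivial : ∀ e : Λ.E, (edgeImage F e).length ≠ 0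
  disjoint : ∀ e e' : Λ.E, e ≠ e' → ∀ d : Λ'.E, ¬ (Occurs d (edgeImage F e) ∧ Occurs d (edgeImage F e'))

theorem occurs_comp {Λ : LatticeGraph.{u}} (d : Λ.E) {x y z : Λ.V} (p : Quiver.Path x y)
    (q : Quiver.Path y z) : Occurs d (p.comp q) ↔ Occurs d p ∨ Occurs d q := by
  induction q with
  | nil => simp [Occurs]
  | cons q e ih => simp [Occurs, ih, or_assoc]

theorem mapPath_nil {Λ Λ' : LatticeGraph.{u}} (F : Λ.PathCat ⥤ Λ'.PathCat) (x : Λ.V) :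
    mapPath F (Quiver.Path.nil : Quiver.Path x x) = Quiver.Path.nil :=
  F.map_id _

theorem mapPath_comp {Λ Λ' : LatticeGraph.{u}} (F : Λ.PathCat ⥤ Λ'.PathCat) {x y z : Λ.V}
    (p : Quiver.Path x y) (q : Quiver.Path y z) :
    mapPath F (p.comp q) = (mapPath F p).comp (mapPath F q) :=
  F.map_comp (X := x) (Y := y) (Z := z) p q

theorem mapPath_cons {Λ Λ' : LatticeGraph.{u}} (F : Λ.PathCat ⥤ Λ'.PathCat) {x y z : Λ.V}
    (p : Quiver.Path x y) (e : y ⟶ z) :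
    mapPath F (p.cons e) = (mapPath F p).comp (mapPath F e.toPath) :=
  mapPath_comp F p e.toPath

theorem occurs_mapPath {Λ Λ' : LatticeGraph.{u}} (F : Λ.PathCat ⥤ Λ'.PathCat) {x y : Λ.V}
    (p : Quiver.Path x y) (d : Λ'.E) :
    Occurs d (mapPath F p) ↔ ∃ e, Occurs e p ∧ Occurs d (edgeImage F e) := by
  induction p with
  | nil => simp [mapPath_nil, Occurs]
  | @cons y z p e ih =>
    rw [mapPath_cons, occurs_comp, ih]
    obtain ⟨e, rfl, rfl⟩ := e
    constructor
    · rintro (⟨e', h, h'⟩ | h)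
      · exact ⟨e', Or.inl h, h'⟩
      · exact ⟨e, Or.inr rfl, h⟩
    · rintro ⟨e', h | rfl, h'⟩
      · exact Or.inl ⟨e', h, h'⟩
      · exact Or.inr h'

theorem length_mapPath {Λ Λ' : LatticeGraph.{u}} {F : Λ.PathCat ⥤ Λ'.PathCat}
    (hF : IsRefinement F) {x y : Λ.V} (p : Quiver.Path x y) (hp : p.length ≠ 0) :
    (mapPath F p).length ≠ 0 := by
  cases p with
  | nil => simp at hp
  | cons p e =>
    rw [mapPath_cons, Quiver.Path.length_comp]
    obtain ⟨e, rfl, rfl⟩ := e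
    have := hF.nontrivial e
    change (mapPath F _).length ≠ 0 at this
    intro h
    exact this (Nat.eq_zero_of_add_eq_zero_left h)

theorem IsRefinement.id (Λ : LatticeGraph.{u}) : IsRefinement (𝟭 Λ.PathCat) where
  obj_injective := fun _ _ h => h
  nontrivial e := by
    change ((Λ.arrow e).toPath).length ≠ 0
    simp
  disjoint e e' h d := by
    change ¬ (Occurs d (Λ.arrow e).toPath ∧ Occurs d (Λ.arrow e').toPath)
    rintro ⟨h1 | h1, h2 | h2⟩
    · exact h1
    · exact h1
    · exact h2
    · exact h (h1.trans h2.symm)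

theorem IsRefinement.comp {Λ Λ' Λ'' : LatticeGraph.{u}} {F : Λ.PathCat ⥤ Λ'.PathCat}
    {F' : Λ'.PathCat ⥤ Λ''.PathCat} (hF : IsRefinement F) (hF' : IsRefinement F') :
    IsRefinement (F ⋙ F') where
  obj_injective := hF'.obj_injective.comp hF.obj_injective
  nontrivial e := length_mapPath hF' (edgeImage F e) (hF.nontrivial e)
  disjoint e e' h d := by
    change ¬ (Occurs d (mapPath F' (edgeImage F e)) ∧ Occurs d (mapPath F' (edgeImage F e')))
    rw [occurs_mapPath, occurs_mapPath]
    rintro ⟨⟨f, hf, hd⟩, ⟨f', hf', hd'⟩⟩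
    by_cases hff : f = f'
    · subst hff
      exact hF.disjoint e e' h f ⟨hf, hf'⟩
    · exact hF'.disjoint f f' hff d ⟨hd, hd'⟩

/-- The category of graphs and refinements. -/
instance : Category.{u} LatticeGraph.{u} where
  Hom Λ Λ' := {F : Λ.PathCat ⥤ Λ'.PathCat // IsRefinement F}
  id Λ := ⟨𝟭 _, IsRefinement.id Λ⟩
  comp F F' := ⟨F.1 ⋙ F'.1, F.2.comp F'.2⟩

/-! ### Configuration spaces and the gauge action -/

variable (G : Type v)

/-- The configuration space `G ^ E` of a graph. -/
def Config (Λ : LatticeGraph.{u}) : Type (max u v) := Λ.E → G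

/-- The gauge group `G ^ V` of a graph. -/
abbrev Gauge (Λ : LatticeGraph.{u}) : Type (max u v) := Λ.V → G

variable {G} (Λ : LatticeGraph.{u})

instance [TopologicalSpace G] : TopologicalSpace (Config G Λ) :=
  inferInstanceAs (TopologicalSpace (Λ.E → G))

instance [TopologicalSpace G] [CompactSpace G] : CompactSpace (Config G Λ) :=
  inferInstanceAs (CompactSpace (Λ.E → G))

instance [TopologicalSpace G] [T2Space G] : T2Space (Config G Λ) :=
  inferInstanceAs (T2Space (Λ.E → G))

instance [TopologicalSpace G] : MeasurableSpace (Config G Λ) := borel _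

instance [TopologicalSpace G] : BorelSpace (Config G Λ) := ⟨rfl⟩

variable [Group G]

instance : Group (Config G Λ) := inferInstanceAs (Group (Λ.E → G))

instance [TopologicalSpace G] [IsTopologicalGroup G] : IsTopologicalGroup (Config G Λ) :=
  inferInstanceAs (IsTopologicalGroup (Λ.E → G))

/-- The gauge group acts by `(g • a) e = g (src e) * a e * (g (tgt e))⁻¹`. -/
instance : MulAction (Gauge G Λ) (Config G Λ) where
  smul g a := fun e => g (Λ.src e) * a e * (g (Λ.tgt e))⁻¹
  one_smul a := by
    funext e
    change (1 : G) * a e * (1 : G)⁻¹ = a e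
    simp
  mul_smul g h a := by
    funext e
    change (g (Λ.src e) * h (Λ.src e)) * a e * (g (Λ.tgt e) * h (Λ.tgt e))⁻¹ =
      g (Λ.src e) * (h (Λ.src e) * a e * (h (Λ.tgt e))⁻¹) * (g (Λ.tgt e))⁻¹
    simp [mul_assoc]

theorem gauge_smul_apply (g : Gauge G Λ) (a : Config G Λ) (e : Λ.E) :
    (g • a) e = g (Λ.src e) * a e * (g (Λ.tgt e))⁻¹ := rfl

variable {Λ}

/-- The product `a e₁ * ⋯ * a eₙ` along the path `(e₁, …, eₙ)`. -/
def holonomy (a : Config G Λ) {x : Λ.V} : ∀ {y : Λ.V}, Quiver.Path x y → G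
  | _, .nil => 1
  | _, .cons p e => holonomy a p * a e.1

theorem holonomy_comp (a : Config G Λ) {x y z : Λ.V} (p : Quiver.Path x y)
    (q : Quiver.Path y z) : holonomy a (p.comp q) = holonomy a p * holonomy a q := by
  induction q with
  | nil => simp [holonomy]
  | cons q e ih => simp [holonomy, ih, mul_assoc]

theorem holonomy_toPath (a : Config G Λ) (e : Λ.E) : holonomy a (Λ.arrow e).toPath = a e := by
  change 1 * a e = a e
  simp

/-- A transformation of configurations that multiplies each edge of a path by vertex factors
changes the holonomy of the path by the factors of its end points. -/
theorem holonomy_transform (a b : Config G Λ) (c : Λ.V → G) {x y : Λ.V} (p : Quiver.Path x y)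
    (h : ∀ d, Occurs d p → b d = c (Λ.src d) * a d * (c (Λ.tgt d))⁻¹) :
    holonomy b p = c x * holonomy a p * (c y)⁻¹ := by
  induction p with
  | nil => simp [holonomy]
  | cons p e ih =>
    obtain ⟨e, rfl, rfl⟩ := e
    have h1 := ih fun d hd => h d (Or.inl hd)
    have h2 := h e (Or.inr rfl)
    change holonomy b p * b e = c x * (holonomy a p * a e) * (c (Λ.tgt e))⁻¹
    rw [h1, h2]
    group

theorem continuous_holonomy [TopologicalSpace G] [IsTopologicalGroup G] {x y : Λ.V}
    (p : Quiver.Path x y) : Continuous fun a : Config G Λ => holonomy a p := by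
  induction p with
  | nil => exact continuous_const
  | cons p e ih => exact ih.mul (continuous_apply (A := fun _ : Λ.E => G) e.1)

variable {Λ' Λ'' : LatticeGraph.{u}}

/-- The map between configuration spaces induced by a refinement. -/
def restrict (F : Λ ⟶ Λ') (a : Config G Λ') : Config G Λ :=
  fun e => holonomy a (edgeImage F.1 e)

theorem continuous_restrict [TopologicalSpace G] [IsTopologicalGroup G] (F : Λ ⟶ Λ') :
    Continuous (restrict F : Config G Λ' → Config G Λ) :=
  continuous_pi fun e => continuous_holonomy (edgeImage F.1 e)

theorem holonomy_restrict (F : Λ ⟶ Λ') (a : Config G Λ') {x y : Λ.V} (p : Quiver.Path x y) :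
    holonomy (restrict F a) p = holonomy a (mapPath F.1 p) := by
  induction p with
  | nil => rw [mapPath_nil]; rfl
  | cons p e ih =>
    obtain ⟨e, rfl, rfl⟩ := e
    rw [mapPath_cons, holonomy_comp, ← ih]
    rfl

theorem restrict_id (a : Config G Λ) : restrict (𝟙 Λ) a = a := by
  funext e
  exact holonomy_toPath a e

theorem restrict_comp (F : Λ ⟶ Λ') (F' : Λ' ⟶ Λ'') (a : Config G Λ'') :
    restrict (F ≫ F') a = restrict F (restrict F' a) := by
  funext e
  exact (holonomy_restrict F' a (edgeImage F.1 e)).symm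

theorem restrict_smul (F : Λ ⟶ Λ') (g : Gauge G Λ') (a : Config G Λ') :
    restrict F (g • a) = (fun x => g (mapVertex F.1 x) : Gauge G Λ) • restrict F a := by
  funext e
  exact holonomy_transform a (g • a) g (edgeImage F.1 e) fun d _ => gauge_smul_apply Λ' g a d

/-! ### Haar measures -/

section Haar

variable [TopologicalSpace G] [IsTopologicalGroup G] [CompactSpace G]

variable (G Λ) in
/-- The normalized Haar measure of the compact group `G ^ E`. -/
def haar : Measure (Config G Λ) := Measure.haarMeasure ⊤

instance : (haar G Λ).IsHaarMeasure := by unfold haar; infer_instance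

instance : IsProbabilityMeasure (haar G Λ) :=
  ⟨by
    have := Measure.haarMeasure_self (K₀ := (⊤ : PositiveCompacts (Config G Λ)))
    simpa [haar] using this⟩

theorem eq_haar (m : Measure (Config G Λ)) [IsProbabilityMeasure m] [m.IsMulLeftInvariant] :
    m = haar G Λ := by
  have h := Measure.isMulInvariant_eq_smul_of_compactSpace m (haar G Λ)
  have h1 : m Set.univ = (Measure.haarScalarFactor m (haar G Λ) • haar G Λ) Set.univ := by
    rw [← h]
  simp only [measure_univ, Measure.smul_apply, ENNReal.smul_def, smul_eq_mul, mul_one] at h1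
  rw [h]
  ext s _
  simp [ENNReal.smul_def, ← h1]

theorem map_mul_right_haar (r : Config G Λ) : (haar G Λ).map (fun a => a * r) = haar G Λ := by
  have hr : Measurable fun a : Config G Λ => a * r := (continuous_mul_const r).measurable
  have : IsProbabilityMeasure ((haar G Λ).map fun a => a * r) :=
    Measure.isProbabilityMeasure_map hr.aemeasurable
  have : ((haar G Λ).map fun a => a * r).IsMulLeftInvariant := ⟨fun l => by
    have hl : Measurable fun a : Config G Λ => l * a := (continuous_const_mul l).measurable
    rw [Measure.map_map hl hr]
    have : (fun a => l * a) ∘ (fun a : Config G Λ => a * r) =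
        (fun a => a * r) ∘ (fun a => l * a) := by
      funext a
      simp [mul_assoc]
    rw [this, ← Measure.map_map hr hl, map_mul_left_eq_self]⟩
  exact eq_haar _

/-- Refinements transport Haar measure to Haar measure. -/
theorem measurePreserving_restrict (F : Λ ⟶ Λ') :
    MeasurePreserving (restrict F) (haar G Λ') (haar G Λ) := by
  classical
  have hm : Measurable (restrict F : Config G Λ' → Config G Λ) :=
    (continuous_restrict F).measurable
  refine ⟨hm, ?_⟩
  have : IsProbabilityMeasure ((haar G Λ').map (restrict F)) :=
    Measure.isProbabilityMeasure_map hm.aemeasurable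
  have : ((haar G Λ').map (restrict F)).IsMulLeftInvariant := ⟨fun h => by
    have hh : Measurable fun a : Config G Λ => h * a := (continuous_const_mul h).measurable
    let c : Λ'.E → Λ'.V → G := fun d v =>
      if H : ∃ e, Occurs d (edgeImage F.1 e) then
        if v = mapVertex F.1 (Λ.src H.choose) then h H.choose else 1 else 1
    have hc : ∀ d e, Occurs d (edgeImage F.1 e) →
        c d = fun v => if v = mapVertex F.1 (Λ.src e) then h e else 1 := by
      intro d e hd
      have H : ∃ e, Occurs d (edgeImage F.1 e) := ⟨e, hd⟩
      have he : H.choose = e := by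
        by_contra hne
        exact F.2.disjoint _ _ hne d ⟨H.choose_spec, hd⟩
      funext v
      simp only [c, dif_pos H]
      rw [he]
    let l : Config G Λ' := fun d => c d (Λ'.src d)
    let r : Config G Λ' := fun d => (c d (Λ'.tgt d))⁻¹
    have key : (fun a : Config G Λ => h * a) ∘ restrict F =
        restrict F ∘ (fun a => a * r) ∘ (fun a => l * a) := by
      funext a e
      have ht := holonomy_transform a (l * a * r)
        (fun v => if v = mapVertex F.1 (Λ.src e) then h e else 1) (edgeImage F.1 e) (fun d hd => by
          change c d (Λ'.src d) * a d * (c d (Λ'.tgt d))⁻¹ = _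
          rw [hc d e hd])
      have hne : mapVertex F.1 (Λ.tgt e) ≠ mapVertex F.1 (Λ.src e) :=
        fun h => Λ.src_ne_tgt e (F.2.obj_injective h).symm
      change h e * holonomy a (edgeImage F.1 e) = holonomy (l * a * r) (edgeImage F.1 e)
      rw [ht, if_neg hne, if_pos rfl]
      simp
    have hl : Measurable fun a : Config G Λ' => l * a := (continuous_const_mul l).measurable
    have hr : Measurable fun a : Config G Λ' => a * r := (continuous_mul_const r).measurable
    rw [Measure.map_map hh hm, key, ← Measure.map_map hm (hr.comp hl), ← Measure.map_map hr hl,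
      map_mul_left_eq_self, map_mul_right_haar]⟩
  exact eq_haar _

end Haar

/-! ### Reduced configuration spaces -/

variable (G Λ) in
/-- The space of gauge orbits of configurations. -/
def RedConfig : Type (max u v) := Quotient (MulAction.orbitRel (Gauge G Λ) (Config G Λ))

/-- The quotient map onto the space of gauge orbits. -/
def toRed (a : Config G Λ) : RedConfig G Λ :=
  Quotient.mk (MulAction.orbitRel (Gauge G Λ) (Config G Λ)) a

/-- The map between spaces of gauge orbits induced by a refinement. -/
def redRestrict (F : Λ ⟶ Λ') : RedConfig G Λ' → RedConfig G Λ :=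
  Quotient.lift (fun a => toRed (restrict F a)) (by
    rintro a b ⟨g, rfl⟩
    refine Quotient.sound ⟨fun x => g (mapVertex F.1 x), ?_⟩
    exact (restrict_smul F g b).symm)

theorem redRestrict_toRed (F : Λ ⟶ Λ') (a : Config G Λ') :
    redRestrict F (toRed a) = toRed (restrict F a) := rfl

theorem redRestrict_id (a : RedConfig G Λ) : redRestrict (𝟙 Λ) a = a := by
  induction a using Quotient.inductionOn with
  | h a => exact congrArg toRed (restrict_id a)

theorem redRestrict_comp (F : Λ ⟶ Λ') (F' : Λ' ⟶ Λ'') (a : RedConfig G Λ'') :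
    redRestrict (F ≫ F') a = redRestrict F (redRestrict F' a) := by
  induction a using Quotient.inductionOn with
  | h a => exact congrArg toRed (restrict_comp F F' a)

section Topology

variable [TopologicalSpace G]

instance : TopologicalSpace (RedConfig G Λ) :=
  inferInstanceAs (TopologicalSpace (Quotient (MulAction.orbitRel (Gauge G Λ) (Config G Λ))))

instance : MeasurableSpace (RedConfig G Λ) := borel _

instance : BorelSpace (RedConfig G Λ) := ⟨rfl⟩

theorem continuous_toRed : Continuous (toRed : Config G Λ → RedConfig G Λ) :=
  continuous_quotient_mk'

instance [CompactSpace G] : CompactSpace (RedConfig G Λ) :=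
  inferInstanceAs (CompactSpace (Quotient (MulAction.orbitRel (Gauge G Λ) (Config G Λ))))

variable [IsTopologicalGroup G]

instance : ContinuousSMul (Gauge G Λ) (Config G Λ) where
  continuous_smul := continuous_pi fun e =>
    (((continuous_apply (Λ.src e)).comp continuous_fst).mul
      ((continuous_apply (A := fun _ : Λ.E => G) e).comp continuous_snd)).mul
      ((continuous_apply (Λ.tgt e)).comp continuous_fst).inv

instance [CompactSpace G] [T2Space G] : T2Space (RedConfig G Λ) := by
  have : ProperSMul (Gauge G Λ) (Config G Λ) :=
    ⟨(continuous_smul.prodMk continuous_snd).isProperMap⟩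
  exact inferInstanceAs (T2Space (Quotient (MulAction.orbitRel (Gauge G Λ) (Config G Λ))))

theorem continuous_redRestrict (F : Λ ⟶ Λ') :
    Continuous (redRestrict F : RedConfig G Λ' → RedConfig G Λ) :=
  Continuous.quotient_lift (continuous_toRed.comp (continuous_restrict F)) _

variable [CompactSpace G]

variable (G Λ) in
/-- The image of Haar measure on the space of gauge orbits. -/
def redHaar : Measure (RedConfig G Λ) := (haar G Λ).map toRed

theorem measurePreserving_redRestrict (F : Λ ⟶ Λ') :
    MeasurePreserving (redRestrict F) (redHaar G Λ') (redHaar G Λ) := by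
  refine ⟨(continuous_redRestrict F).measurable, ?_⟩
  unfold redHaar
  rw [Measure.map_map (continuous_redRestrict F).measurable continuous_toRed.measurable]
  have : redRestrict F ∘ toRed = toRed ∘ (restrict F : Config G Λ' → Config G Λ) := rfl
  rw [this, ← Measure.map_map continuous_toRed.measurable (continuous_restrict F).measurable,
    (measurePreserving_restrict F).map_eq]

end Topology

end LatticeGraph


/-! ### Compact operators -/

section Compact

variable {H : Type u} [NormedAddCommGroup H] [InnerProductSpace ℂ H] [CompleteSpace H]
variable {K : Type v} [NormedAddCommGroup K] [InnerProductSpace ℂ K] [CompleteSpace K]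

theorem IsCompactOperator.star_clm {T : H →L[ℂ] H} (hT : IsCompactOperator T) :
    IsCompactOperator (star T : H →L[ℂ] H) := by
  have hS : IsCompactOperator (T * star T : H →L[ℂ] H) := hT.comp_clm (star T)
  have hest : ∀ z : H, ‖(star T) z‖ ^ 2 ≤ ‖(T * star T) z‖ * ‖z‖ := by
    intro z
    have h1 : inner ℂ ((T * star T) z) z = inner ℂ ((star T) z) ((star T) z) := by
      rw [ContinuousLinearMap.star_eq_adjoint, ContinuousLinearMap.adjoint_inner_right]
      rfl
    have h2 : ‖inner ℂ ((star T) z) ((star T) z)‖ = ‖(star T) z‖ ^ 2 := by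
      rw [inner_self_eq_norm_sq_to_K]
      simp
    rw [← h2, ← h1]
    exact norm_inner_le_norm _ _
  refine (isCompactOperator_iff_isCompact_closure_image_closedBall
    (star T : H →L[ℂ] H).toLinearMap one_pos).2 ?_
  have hSc := (isCompactOperator_iff_isCompact_closure_image_closedBall
    (T * star T : H →L[ℂ] H).toLinearMap one_pos).1 hS
  refine (TotallyBounded.closure ?_).isCompact_of_isClosed isClosed_closure
  rw [Metric.totallyBounded_iff]
  intro ε hε
  have hSt := (hSc.totallyBounded).subset subset_closure
  obtain ⟨t, hts, htf, ht⟩ := Metric.finite_approx_of_totallyBounded hSt (ε ^ 2 / 2)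
    (by positivity)
  choose g hg using fun z : t => hts z.2
  have : Finite t := htf
  refine ⟨Set.range fun z => (star T : H →L[ℂ] H) (g z), Set.finite_range _, ?_⟩
  rintro _ ⟨x, hx, rfl⟩
  have hx' := ht ⟨x, hx, rfl⟩
  simp only [Set.mem_iUnion] at hx' ⊢
  obtain ⟨z, hz, hxy⟩ := hx'
  refine ⟨(star T : H →L[ℂ] H) (g ⟨z, hz⟩), ⟨⟨z, hz⟩, rfl⟩, ?_⟩
  obtain ⟨hy, hyz⟩ := hg ⟨z, hz⟩
  generalize g ⟨z, hz⟩ = y at hy hyz ⊢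
  change (T * star T : H →L[ℂ] H) y = z at hyz
  subst hyz
  rw [Metric.mem_ball, dist_eq_norm] at hxy ⊢
  have hb : ‖x - y‖ ≤ 2 := by
    have h1 : ‖x‖ ≤ 1 := by simpa using hx
    have h2 : ‖y‖ ≤ 1 := by simpa using hy
    linarith [norm_sub_le x y]
  have h3 := hest (x - y)
  rw [map_sub, map_sub] at h3
  have h4 : ‖(star T : H →L[ℂ] H) x - (star T : H →L[ℂ] H) y‖ ^ 2 < ε ^ 2 := by
    have h5 : ‖(T * star T) x - (T * star T) y‖ < ε ^ 2 / 2 := hxy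
    nlinarith [norm_nonneg ((T * star T) x - (T * star T) y), norm_nonneg (x - y)]
  exact lt_of_pow_lt_pow_left₀ 2 hε.le h4

variable (H) in
/-- The C⋆-algebra of compact operators on a Hilbert space. -/
def CompactOps : NonUnitalStarSubalgebra ℂ (H →L[ℂ] H) where
  carrier := {T | IsCompactOperator T}
  add_mem' hS hT := hS.add hT
  zero_mem' := isCompactOperator_zero
  mul_mem' {_ T} hS _ := hS.comp_clm T
  smul_mem' c _ hT := hT.smul c
  star_mem' hT := hT.star_clm

instance : IsClosed (CompactOps H : Set (H →L[ℂ] H)) :=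
  isClosed_setOfPred_isCompactOperator

/-- Conjugation `T ↦ u T u⋆` of bounded operators by an isometry. -/
def conjOp (u : H →ₗᵢ[ℂ] K) (T : H →L[ℂ] H) : K →L[ℂ] K :=
  u.toContinuousLinearMap ∘L T ∘L u.toContinuousLinearMap.adjoint

theorem conjOp_apply (u : H →ₗᵢ[ℂ] K) (T : H →L[ℂ] H) (x : K) :
    conjOp u T x = u (T (u.toContinuousLinearMap.adjoint x)) := rfl

theorem conjOp_mul (u : H →ₗᵢ[ℂ] K) (S T : H →L[ℂ] H) :
    conjOp u (S * T) = conjOp u S * conjOp u T := by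
  ext x
  have h : ∀ z, u.toContinuousLinearMap.adjoint (u z) = z :=
    fun z => DFunLike.congr_fun u.adjoint_comp_self z
  change _ = conjOp u S (conjOp u T x)
  rw [conjOp_apply, conjOp_apply, conjOp_apply, h]
  rfl

theorem conjOp_star (u : H →ₗᵢ[ℂ] K) (T : H →L[ℂ] H) :
    conjOp u (star T) = star (conjOp u T) := by
  unfold conjOp
  rw [ContinuousLinearMap.star_eq_adjoint, ContinuousLinearMap.star_eq_adjoint,
    ContinuousLinearMap.adjoint_comp, ContinuousLinearMap.adjoint_comp,
    ContinuousLinearMap.adjoint_adjoint, ContinuousLinearMap.comp_assoc]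

theorem conjOp_add (u : H →ₗᵢ[ℂ] K) (S T : H →L[ℂ] H) :
    conjOp u (S + T) = conjOp u S + conjOp u T := by
  ext x
  exact map_add u _ _

theorem conjOp_zero (u : H →ₗᵢ[ℂ] K) : conjOp u (0 : H →L[ℂ] H) = 0 := by
  ext x
  exact map_zero u

theorem conjOp_smul (u : H →ₗᵢ[ℂ] K) (c : ℂ) (T : H →L[ℂ] H) :
    conjOp u (c • T) = c • conjOp u T := by
  ext x
  exact map_smul u c _

/-- Conjugation `b ↦ u b u⋆` of compact operators by an isometry, a ⋆-homomorphism. -/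
def CompactOps.conj (u : H →ₗᵢ[ℂ] K) : CompactOps H →⋆ₙₐ[ℂ] CompactOps K where
  toFun b := ⟨conjOp u b.1,
    (b.2.comp_clm u.toContinuousLinearMap.adjoint).clm_comp u.toContinuousLinearMap⟩
  map_smul' c b := Subtype.ext (conjOp_smul u c b.1)
  map_zero' := Subtype.ext (conjOp_zero u)
  map_add' b c := Subtype.ext (conjOp_add u b.1 c.1)
  map_mul' b c := Subtype.ext (conjOp_mul u b.1 c.1)
  map_star' b := Subtype.ext (conjOp_star u b.1)

end Compact

/-! ### Bounded families of operators -/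

/-- The C⋆-algebra of bounded families of bounded operators on a family of Hilbert spaces (that is,
of block diagonal operators on their direct sum). -/
def BlockOps {ι : Type u} (H : ι → Type v) [∀ i, NormedAddCommGroup (H i)]
    [∀ i, InnerProductSpace ℂ (H i)] [∀ i, CompleteSpace (H i)] : Type (max u v) :=
  lp (fun i => H i →L[ℂ] H i) ∞

instance {ι : Type u} (H : ι → Type v) [∀ i, NormedAddCommGroup (H i)]
    [∀ i, InnerProductSpace ℂ (H i)] [∀ i, CompleteSpace (H i)] :
    NonUnitalCStarAlgebra (BlockOps H) :=
  inferInstanceAs (NonUnitalCStarAlgebra (lp (fun i => H i →L[ℂ] H i) ∞))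

/-- The C⋆-subalgebra generated by a set. -/
def generatedCStar {A : Type u} [NonUnitalCStarAlgebra A] (s : Set A) :
    NonUnitalStarSubalgebra ℂ A :=
  (NonUnitalStarAlgebra.adjoin ℂ s).topologicalClosure

instance {A : Type u} [NonUnitalCStarAlgebra A] (s : Set A) :
    IsClosed (generatedCStar s : Set A) :=
  NonUnitalStarSubalgebra.isClosed_topologicalClosure _

theorem mem_generatedCStar {A : Type u} [NonUnitalCStarAlgebra A] {s : Set A} {x : A}
    (hx : x ∈ s) : x ∈ generatedCStar s :=
  NonUnitalStarSubalgebra.le_topologicalClosure _ (NonUnitalStarAlgebra.subset_adjoin ℂ s hx)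

/-! ### Direct limits of C⋆-algebras -/

section DirectLimit

variable {I : Type u} [Preorder I] {A : I → Type v} [∀ i, NonUnitalCStarAlgebra (A i)]

/-- A representation on a Hilbert space of a direct system of C⋆-algebras: a compatible family of
representations of its members. -/
structure SystemRep (φ : ∀ ⦃i j : I⦄, i ≤ j → A i →⋆ₙₐ[ℂ] A j) : Type (max u v + 1) where
  H : Type (max u v)
  [normed : NormedAddCommGroup H]
  [inner : InnerProductSpace ℂ H]
  [complete : CompleteSpace H]
  rep : ∀ i, A i →⋆ₙₐ[ℂ] (H →L[ℂ] H)
  compatible : ∀ ⦃i j : I⦄ (h : i ≤ j) (a : A i), rep j (φ h a) = rep i a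

attribute [instance] SystemRep.normed SystemRep.inner SystemRep.complete

variable (φ : ∀ ⦃i j : I⦄, i ≤ j → A i →⋆ₙₐ[ℂ] A j)

/-- The family of the images of `a` under all representations of the system; it is bounded by
`‖a‖`. -/
def universalImage (i : I) (a : A i) : BlockOps fun ρ : SystemRep φ => ρ.H :=
  ⟨fun ρ => ρ.rep i a, memℓp_infty ⟨‖a‖, by
    rintro _ ⟨ρ, rfl⟩
    exact NonUnitalStarAlgHom.norm_apply_le (ρ.rep i) a⟩⟩

/-- The direct limit, in the category of C⋆-algebras, of a direct system: the C⋆-algebra generated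
by the members of the system in the universal (direct sum of all) representation of the system.
Its norm is the supremum over all representations, so that every compatible family of
⋆-homomorphisms factors uniquely through it. -/
def CStarDirectLimit : Type (max u v + 1) :=
  generatedCStar {x | ∃ (i : I) (a : A i), universalImage φ i a = x}

instance : NonUnitalCStarAlgebra (CStarDirectLimit φ) :=
  inferInstanceAs (NonUnitalCStarAlgebra
    (generatedCStar {x | ∃ (i : I) (a : A i), universalImage φ i a = x}))

/-- The canonical map of a member of a direct system to the direct limit. -/
def CStarDirectLimit.of (i : I) (a : A i) : CStarDirectLimit φ :=
  ⟨universalImage φ i a, mem_generatedCStar ⟨i, a, rfl⟩⟩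

end DirectLimit

/-! ### The C⋆-algebra of a pair groupoid -/

section PairGroupoid

variable {X : Type u} [TopologicalSpace X] [CompactSpace X] [MeasurableSpace X] [BorelSpace X]
variable (μ : Measure X)

/-- The convolution product of the pair groupoid `X × X`. -/
def pairConv [IsFiniteMeasureOnCompacts μ] (f g : C(X × X, ℂ)) : C(X × X, ℂ) where
  toFun p := ∫ y, f (y, p.2) * g (p.1, y) ∂μ
  continuous_toFun := by
    rw [← continuousOn_univ]
    exact continuousOn_integral_of_compact_support (k := Set.univ)
      (f := fun (p : X × X) y => f (y, p.2) * g (p.1, y)) isCompact_univ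
      (Continuous.continuousOn (by unfold Function.uncurry; fun_prop)) (fun _ _ _ h => (h (Set.mem_univ _)).elim)

/-- The involution of the pair groupoid `X × X`. -/
def pairStar (f : C(X × X, ℂ)) : C(X × X, ℂ) where
  toFun p := star (f (p.2, p.1))

/-- The `I`-norm on the convolution algebra of the pair groupoid `X × X`: the larger one of the
suprema over `x` of the integrals of `|f|` over the source fibre and over the target fibre of
`x`. -/
def pairINorm (f : C(X × X, ℂ)) : ℝ :=
  max (⨆ x, ∫ y, ‖f (x, y)‖ ∂μ) (⨆ x, ∫ y, ‖f (y, x)‖ ∂μ)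

variable [IsFiniteMeasureOnCompacts μ]

/-- A bounded ⋆-representation of the convolution algebra of the pair groupoid `X × X`. -/
structure PairRep : Type (u + 1) where
  H : Type u
  [normed : NormedAddCommGroup H]
  [inner : InnerProductSpace ℂ H]
  [complete : CompleteSpace H]
  rep : C(X × X, ℂ) →ₗ[ℂ] (H →L[ℂ] H)
  map_conv : ∀ f g, rep (pairConv μ f g) = rep f * rep g
  map_star : ∀ f, rep (pairStar f) = star (rep f)
  norm_le : ∀ f, ‖rep f‖ ≤ pairINorm μ f

attribute [instance] PairRep.normed PairRep.inner PairRep.complete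

/-- The family of the images of `f` under all bounded ⋆-representations. -/
def pairUniversalImage (f : C(X × X, ℂ)) : BlockOps fun ρ : PairRep μ => ρ.H :=
  ⟨fun ρ => ρ.rep f, memℓp_infty ⟨pairINorm μ f, by
    rintro _ ⟨ρ, rfl⟩
    exact ρ.norm_le f⟩⟩

/-- The (full) groupoid C⋆-algebra of the pair groupoid `X × X` of a compact space `X`, for the
Haar system given by `μ`: the completion of the convolution algebra in the norm
`f ↦ sup ‖π f‖`, the supremum over all bounded ⋆-representations `π`, realized as the closure of
the convolution algebra in its universal representation. -/
def PairGroupoidCStar : Type (u + 1) := generatedCStar (Set.range (pairUniversalImage μ))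

instance : NonUnitalCStarAlgebra (PairGroupoidCStar μ) :=
  inferInstanceAs (NonUnitalCStarAlgebra (generatedCStar (Set.range (pairUniversalImage μ))))

/-- The canonical map of the convolution algebra to the groupoid C⋆-algebra. -/
def PairGroupoidCStar.of (f : C(X × X, ℂ)) : PairGroupoidCStar μ :=
  ⟨pairUniversalImage μ f, mem_generatedCStar ⟨f, rfl⟩⟩

end PairGroupoid

/-! ### Inverse systems of compact measure spaces -/

/-- An inverse system of compact Hausdorff spaces with an exact inverse system of Borel
measures. -/
structure MeasInvSystem (I : Type u) [Preorder I] : Type (max u (v + 1)) where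
  X : I → Type v
  [top : ∀ i, TopologicalSpace (X i)]
  [compact : ∀ i, CompactSpace (X i)]
  [t2 : ∀ i, T2Space (X i)]
  [meas : ∀ i, MeasurableSpace (X i)]
  [borel : ∀ i, BorelSpace (X i)]
  R : ∀ ⦃i j : I⦄, i ≤ j → X j → X i
  continuous_R : ∀ ⦃i j : I⦄ (h : i ≤ j), Continuous (R h)
  R_id : ∀ (i : I) (x : X i), R (le_refl i) x = x
  R_comp : ∀ ⦃i j k : I⦄ (hij : i ≤ j) (hjk : j ≤ k) (x : X k),
    R (hij.trans hjk) x = R hij (R hjk x)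
  μ : ∀ i, Measure (X i)
  measurePreserving_R : ∀ ⦃i j : I⦄ (h : i ≤ j), MeasurePreserving (R h) (μ j) (μ i)

namespace MeasInvSystem

attribute [instance] top compact t2 meas borel

variable {I : Type u} [Preorder I] (S : MeasInvSystem.{u, v} I)

/-- The inverse limit space, as a subspace of the product. -/
def Limit : Type (max u v) := {a : ∀ i, S.X i // ∀ ⦃i j : I⦄ (h : i ≤ j), a i = S.R h (a j)}

instance : TopologicalSpace S.Limit := instTopologicalSpaceSubtype

instance : MeasurableSpace S.Limit := _root_.borel _

instance : BorelSpace S.Limit := ⟨rfl⟩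

instance : CompactSpace S.Limit := by
  have h : IsClosed {a : ∀ i, S.X i | ∀ ⦃i j : I⦄ (h : i ≤ j), a i = S.R h (a j)} := by
    simp only [Set.ofPred_forall]
    exact isClosed_iInter fun i => isClosed_iInter fun j => isClosed_iInter fun h =>
      isClosed_eq (continuous_apply i) ((S.continuous_R h).comp (continuous_apply j))
  exact isCompact_iff_compactSpace.1 h.isCompact

instance : T2Space S.Limit := inferInstanceAs (T2Space (Subtype _))

/-- The canonical projections of the inverse limit. -/
def proj (i : I) (a : S.Limit) : S.X i := a.1 i

/-- The isometry `ψ ↦ ψ ∘ R` between the `L²` spaces. -/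
def isometry ⦃i j : I⦄ (h : i ≤ j) : Lp ℂ 2 (S.μ i) →ₗᵢ[ℂ] Lp ℂ 2 (S.μ j) :=
  Lp.compMeasurePreservingₗᵢ ℂ (S.R h) (S.measurePreserving_R h)

/-- The observable algebra, the compact operators on `L²`, of a member of the system. -/
abbrev Obs (i : I) : Type v := CompactOps (Lp ℂ 2 (S.μ i))

/-- The connecting map `b ↦ u b u⋆` between the observable algebras. -/
def connect ⦃i j : I⦄ (h : i ≤ j) : S.Obs i →⋆ₙₐ[ℂ] S.Obs j := CompactOps.conj (S.isometry h)

/-- The limit observable algebra. -/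
abbrev LimitObs := CStarDirectLimit S.connect

end MeasInvSystem

namespace LatticeGraph

variable {I : Type u} [Preorder I] (G : Type v) [Group G] [TopologicalSpace G]
  [IsTopologicalGroup G] [CompactSpace G] [T2Space G] (Λ : I ⥤ LatticeGraph.{w})

/-- The inverse system of the configuration spaces of a direct system of graphs, with the
normalized Haar measures. -/
def configSystem : MeasInvSystem.{u, max v w} I where
  X i := Config G (Λ.obj i)
  R _ _ h := restrict (Λ.map (homOfLE h))
  continuous_R _ _ h := continuous_restrict _
  R_id i x := by
    have : homOfLE (le_refl i) = 𝟙 i := rfl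
    rw [this, Λ.map_id, restrict_id]
  R_comp i j k hij hjk x := by
    rw [← restrict_comp, ← Λ.map_comp, homOfLE_comp]
  μ i := haar G (Λ.obj i)
  measurePreserving_R _ _ h := measurePreserving_restrict _

/-- The inverse system of the spaces of gauge orbits of a direct system of graphs, with the
images of the normalized Haar measures. -/
def reducedSystem : MeasInvSystem.{u, max v w} I where
  X i := RedConfig G (Λ.obj i)
  R _ _ h := redRestrict (Λ.map (homOfLE h))
  continuous_R _ _ h := continuous_redRestrict _
  R_id i x := by
    have : homOfLE (le_refl i) = 𝟙 i := rfl
    rw [this, Λ.map_id, redRestrict_id]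
  R_comp i j k hij hjk x := by
    rw [← redRestrict_comp, ← Λ.map_comp, homOfLE_comp]
  μ i := redHaar G (Λ.obj i)
  measurePreserving_R _ _ h := measurePreserving_redRestrict _

end LatticeGraph

end

/-!
The measure `μ` comes from the integral of cylinder functions (continuous functions factoring
through some `X i`): it is a positive functional on a dense subspace of `C(X_∞, ℝ)`, M. Riesz's
extension theorem extends it, and the Riesz representation theorem turns it into a measure.
Uniqueness is density of the cylinder functions, and full support holds because the preimages of
open sets of the `X i` form a basis of `X_∞`.

The `L²(X i)` have dense union in `L²(X_∞)`. If `P i` is the projection onto `L²(X i)`, then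
`P i ∘ T ∘ P i` tends to `T` for compact `T`, so `B₀(L²(X_∞))` is the closure of the union of the
images of the `B₀(L²(X i))`. These images are carried isometrically, and a ⋆-representation of the
system is automatically contractive, so this closure is the direct limit.

For the groupoid algebra, the integral operators `T_h` give one bounded ⋆-representation, with
range dense in the compact operators because it contains the rank-one operators between continuous
functions. The point is that it dominates every other bounded ⋆-representation `π`. For
self-adjoint `g` the kernel of the `n`-th convolution power is built from `n - 2` applications of
`T_g` to the rows of `g`, so its supremum norm is at most `C * ‖T_g‖ ^ n`; since
`‖π g‖ ^ n = ‖π (g ^ n)‖` when `n` is a power of two, `‖π g‖ ≤ ‖T_g‖`.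
-/

open Filter Topology

/-! ### The limit measure -/

section RegularMeasures

variable {X : Type*} [TopologicalSpace X] [MeasurableSpace X] [BorelSpace X]

theorem regular_map_of_continuous {Y : Type*} [TopologicalSpace Y] [T2Space Y] [MeasurableSpace Y]
    [BorelSpace Y] {μ : Measure X} [IsFiniteMeasure μ] [μ.Regular] {f : X → Y}
    (hf : Continuous f) : (μ.map f).Regular := by
  have : (μ.map f).InnerRegular := Measure.InnerRegular.map_of_continuous hf
  infer_instance

variable [CompactSpace X]

theorem integrable_continuousMap {E : Type*} [NormedAddCommGroup E]
    [SecondCountableTopologyEither X E] (μ : Measure X) [IsFiniteMeasureOnCompacts μ]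
    (f : C(X, E)) : Integrable f μ :=
  f.continuous.integrable_of_hasCompactSupport (.of_compactSpace f)

theorem continuous_integral_continuousMap (μ : Measure X) [IsFiniteMeasure μ] :
    Continuous fun f : C(X, ℝ) => ∫ x, f x ∂μ :=
  (continuous_integral.comp (ContinuousMap.toLp 1 μ ℝ).continuous).congr fun f =>
    integral_congr_ae (ContinuousMap.coeFn_toLp μ f)

theorem measure_ext_of_integral_continuousMap [T2Space X] {μ ν : Measure X} [μ.Regular]
    [ν.Regular] (h : ∀ f : C(X, ℝ), ∫ x, f x ∂μ = ∫ x, f x ∂ν) : μ = ν :=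
  Measure.ext_of_integral_eq_on_compactlySupported fun f => h f

theorem exists_regular_integral_eq_of_nonneg [T2Space X] (L : C(X, ℝ) →ₗ[ℝ] ℝ)
    (hL : ∀ f, 0 ≤ f → 0 ≤ L f) :
    ∃ μ : Measure X, μ.Regular ∧ ∀ f : C(X, ℝ), ∫ x, f x ∂μ = L f := by
  let L' : CompactlySupportedContinuousMap X ℝ →ₚ[ℝ] ℝ := PositiveLinearMap.mk₀
    { toFun := fun f => L f.toContinuousMap
      map_add' := fun f g => L.map_add f.toContinuousMap g.toContinuousMap
      map_smul' := fun c f => L.map_smul c f.toContinuousMap } fun f hf => hL _ fun x => hf x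
  exact ⟨RealRMK.rieszMeasure L', inferInstance, fun f =>
    RealRMK.integral_rieszMeasure L' (CompactlySupportedContinuousMap.continuousMapEquiv f)⟩

end RegularMeasures

namespace MeasInvSystem

variable {I : Type u} [Preorder I] (S : MeasInvSystem.{u, v} I)

theorem continuous_proj (i : I) : Continuous (S.proj i) :=
  (continuous_apply i).comp continuous_subtype_val

theorem R_proj {i j : I} (h : i ≤ j) (a : S.Limit) : S.R h (S.proj j a) = S.proj i a :=
  (a.2 h).symm

theorem surjective_R [∀ i, (S.μ i).IsOpenPosMeasure] {i j : I} (h : i ≤ j) :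
    Function.Surjective (S.R h) := by
  have hclosed : IsClosed (Set.range (S.R h)) := (isCompact_range (S.continuous_R h)).isClosed
  have hnull : S.μ i (Set.range (S.R h))ᶜ = 0 := by
    rw [← (S.measurePreserving_R h).measure_preimage
      hclosed.isOpen_compl.measurableSet.nullMeasurableSet]
    simp
  rw [← Set.range_eq_univ, ← Set.compl_empty_iff]
  exact (hclosed.isOpen_compl.measure_eq_zero_iff _).1 hnull

/-- The families of points that are compatible up to the index `m`. They form a decreasing family
of closed sets with intersection the inverse limit. -/
def partialThreads (m : I) : Set (∀ i, S.X i) := {a | ∀ ⦃i⦄ (h : i ≤ m), a i = S.R h (a m)}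

theorem isClosed_partialThreads (m : I) : IsClosed (S.partialThreads m) := by
  simp only [partialThreads, Set.ofPred_forall]
  exact isClosed_iInter fun i => isClosed_iInter fun h =>
    isClosed_eq (continuous_apply i) ((S.continuous_R h).comp (continuous_apply m))

theorem antitone_partialThreads : Antitone S.partialThreads := by
  intro m l hml a ha i h
  rw [ha (h.trans hml), ha hml, S.R_comp]

theorem exists_mem_partialThreads [∀ i, Nonempty (S.X i)] {m : I} (y : S.X m) :
    ∃ a ∈ S.partialThreads m, a m = y := by
  classical
  refine ⟨fun i => if h : i ≤ m then S.R h y else Classical.arbitrary _, fun i h => ?_, ?_⟩ <;>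
    simp [*, S.R_id]

theorem surjective_proj [IsDirectedOrder I]
    (hR : ∀ ⦃i j : I⦄ (h : i ≤ j), Function.Surjective (S.R h)) (k : I) :
    Function.Surjective (S.proj k) := by
  intro x
  have : Nonempty I := ⟨k⟩
  have : ∀ i, Nonempty (S.X i) := fun i => by
    obtain ⟨l, hil, hkl⟩ := exists_ge_ge i k
    exact ⟨S.R hil (hR hkl x).choose⟩
  let T (m : I) : Set (∀ i, S.X i) := S.partialThreads m ∩ {a | a k = x}
  have hT : Antitone T := fun m l h => Set.inter_subset_inter_left _ (S.antitone_partialThreads h)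
  have hclosed (m : I) : IsClosed (T m) := (S.isClosed_partialThreads m).inter
    (isClosed_eq (continuous_apply k) continuous_const)
  have hne (m : I) : (T m).Nonempty := by
    obtain ⟨l, hml, hkl⟩ := exists_ge_ge m k
    obtain ⟨y, rfl⟩ := hR hkl x
    obtain ⟨a, ha, rfl⟩ := S.exists_mem_partialThreads y
    exact ⟨a, hT hml ⟨ha, ha hkl⟩⟩
  obtain ⟨a, ha⟩ := IsCompact.nonempty_iInter_of_directed_nonempty_isCompact_isClosed T
    hT.directed_ge hne (fun m => (hclosed m).isCompact) hclosed
  rw [Set.mem_iInter] at ha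
  exact ⟨⟨a, fun i j h => (ha j).1 h⟩, (ha k).2⟩

theorem exists_preimage_proj_subset [IsDirectedOrder I] [Nonempty I] {a : S.Limit}
    {U : Set S.Limit} (hU : U ∈ 𝓝 a) :
    ∃ i, ∃ V : Set (S.X i), IsOpen V ∧ S.proj i a ∈ V ∧ S.proj i ⁻¹' V ⊆ U := by
  have hnhds : 𝓝 a = ⨅ i, comap (S.proj i) (𝓝 (S.proj i a)) := by
    refine (nhds_induced Subtype.val a).trans ?_
    simp only [nhds_pi, Filter.pi, comap_iInf, comap_comap]
    rfl
  have hdir : Directed (· ≥ ·) fun i => comap (S.proj i) (𝓝 (S.proj i a)) :=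
    Antitone.directed_ge fun i j h => by
      have hproj : S.proj i = S.R h ∘ S.proj j := funext fun b => (S.R_proj h b).symm
      rw [hproj, ← comap_comap, Function.comp_apply]
      exact comap_mono ((S.continuous_R h).tendsto _).le_comap
  rw [hnhds, mem_iInf_of_directed hdir] at hU
  obtain ⟨i, W, hW, hWU⟩ := hU
  obtain ⟨V, hVW, hV, haV⟩ := mem_nhds_iff.1 hW
  exact ⟨i, V, hV, haV, (Set.preimage_mono hVW).trans hWU⟩

section Cylinder

variable (𝕜 : Type*) [RCLike 𝕜]

/-- The pullback of continuous functions along a projection of the inverse limit. -/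
def pullback (i : I) : C(S.X i, 𝕜) →⋆ₐ[𝕜] C(S.Limit, 𝕜) :=
  ContinuousMap.compStarAlgHom' 𝕜 𝕜 ⟨S.proj i, S.continuous_proj i⟩

/-- The composition of a continuous function with a map of the system. -/
def pullbackR {i j : I} (h : i ≤ j) (f : C(S.X i, 𝕜)) : C(S.X j, 𝕜) :=
  f.comp ⟨S.R h, S.continuous_R h⟩

theorem pullback_pullbackR {i j : I} (h : i ≤ j) (f : C(S.X i, 𝕜)) :
    S.pullback 𝕜 j (S.pullbackR 𝕜 h f) = S.pullback 𝕜 i f :=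
  ContinuousMap.ext fun a => congrArg f (S.R_proj h a)

variable [IsDirectedOrder I] [Nonempty I]

/-- The algebra of cylinder functions: the continuous functions on the inverse limit that factor
through one of the projections. -/
def cylinder : StarSubalgebra 𝕜 C(S.Limit, 𝕜) where
  carrier := {F | ∃ i f, S.pullback 𝕜 i f = F}
  mul_mem' := by
    rintro _ _ ⟨i, f, rfl⟩ ⟨j, g, rfl⟩
    obtain ⟨k, hik, hjk⟩ := exists_ge_ge i j
    exact ⟨k, S.pullbackR 𝕜 hik f * S.pullbackR 𝕜 hjk g, by simp only [map_mul, pullback_pullbackR]⟩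
  add_mem' := by
    rintro _ _ ⟨i, f, rfl⟩ ⟨j, g, rfl⟩
    obtain ⟨k, hik, hjk⟩ := exists_ge_ge i j
    exact ⟨k, S.pullbackR 𝕜 hik f + S.pullbackR 𝕜 hjk g, by simp only [map_add, pullback_pullbackR]⟩
  algebraMap_mem' c := ⟨Classical.arbitrary I, algebraMap 𝕜 _ c, AlgHomClass.commutes _ c⟩
  star_mem' := by
    rintro _ ⟨i, f, rfl⟩
    exact ⟨i, star f, map_star _ f⟩

theorem separatesPoints_cylinder : (S.cylinder 𝕜).toSubalgebra.SeparatesPoints := by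
  intro a b hab
  obtain ⟨i, hi⟩ : ∃ i, S.proj i a ≠ S.proj i b := by
    by_contra! h
    exact hab (Subtype.ext (funext h))
  obtain ⟨f, hfa, hfb, -⟩ := exists_continuous_zero_one_of_isClosed
    (isClosed_singleton (x := S.proj i a)) (isClosed_singleton (x := S.proj i b))
    (by simpa using hi)
  let f' : C(S.X i, 𝕜) := ⟨fun x => (f x : 𝕜), by fun_prop⟩
  refine ⟨_, ⟨S.pullback 𝕜 i f', ⟨i, f', rfl⟩, rfl⟩, ?_⟩
  change ((f (S.proj i a) : ℝ) : 𝕜) ≠ ((f (S.proj i b) : ℝ) : 𝕜)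
  rw [hfa rfl, hfb rfl]
  simp

theorem dense_cylinder : Dense (S.cylinder 𝕜 : Set C(S.Limit, 𝕜)) := by
  rw [dense_iff_closure_eq, ← StarSubalgebra.topologicalClosure_coe,
    ContinuousMap.starSubalgebra_topologicalClosure_eq_top_of_separatesPoints _
      (S.separatesPoints_cylinder 𝕜)]
  rfl

end Cylinder

theorem integral_pullbackR {i j : I} (h : i ≤ j) (f : C(S.X i, ℝ)) :
    ∫ x, S.pullbackR ℝ h f x ∂S.μ j = ∫ x, f x ∂S.μ i := by
  rw [← (S.measurePreserving_R h).map_eq, integral_map (S.measurePreserving_R h).aemeasurable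
    f.continuous.aestronglyMeasurable]
  rfl

theorem integral_pullback {ν : Measure S.Limit} {i : I}
    (hν : MeasurePreserving (S.proj i) ν (S.μ i)) (f : C(S.X i, ℝ)) :
    ∫ a, S.pullback ℝ i f a ∂ν = ∫ x, f x ∂S.μ i := by
  rw [← hν.map_eq, integral_map hν.aemeasurable f.continuous.aestronglyMeasurable]
  rfl

variable [IsDirectedOrder I] [Nonempty I]

section Existence

variable [∀ i, IsFiniteMeasure (S.μ i)]

/-- The graph of the integral of cylinder functions. -/
def cylinderIntegralGraph : Submodule ℝ (C(S.Limit, ℝ) × ℝ) where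
  carrier := {p | ∃ i f, S.pullback ℝ i f = p.1 ∧ ∫ x, f x ∂S.μ i = p.2}
  add_mem' := by
    rintro ⟨_, _⟩ ⟨_, _⟩ ⟨i, f, rfl, rfl⟩ ⟨j, g, rfl, rfl⟩
    obtain ⟨k, hik, hjk⟩ := exists_ge_ge i j
    refine ⟨k, S.pullbackR ℝ hik f + S.pullbackR ℝ hjk g, ?_, ?_⟩
    · simp only [map_add, pullback_pullbackR, Prod.mk_add_mk]
    · simp only [ContinuousMap.add_apply, Prod.mk_add_mk]
      rw [integral_add (integrable_continuousMap _ _) (integrable_continuousMap _ _),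
        integral_pullbackR, integral_pullbackR]
  zero_mem' := ⟨Classical.arbitrary I, 0, map_zero _, by simp⟩
  smul_mem' := by
    rintro c ⟨_, _⟩ ⟨i, f, rfl, rfl⟩
    exact ⟨i, c • f, map_smul _ _ _, integral_const_mul _ _⟩

theorem nonneg_of_mem_cylinderIntegralGraph [∀ i, (S.μ i).IsOpenPosMeasure] {F : C(S.Limit, ℝ)}
    {r : ℝ} (h : (F, r) ∈ S.cylinderIntegralGraph) (hF : 0 ≤ F) : 0 ≤ r := by
  obtain ⟨i, f, rfl, rfl⟩ := h
  refine integral_nonneg fun x => ?_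
  obtain ⟨a, rfl⟩ := S.surjective_proj (fun _ _ h => S.surjective_R h) i x
  exact hF a

theorem eq_zero_of_mem_cylinderIntegralGraph [∀ i, (S.μ i).IsOpenPosMeasure]
    {p : C(S.Limit, ℝ) × ℝ} (hp : p ∈ S.cylinderIntegralGraph) (h : p.1 = 0) : p.2 = 0 := by
  obtain ⟨F, r⟩ := p
  obtain rfl : F = 0 := h
  have hneg : (0, -r) ∈ S.cylinderIntegralGraph := by simpa using neg_mem hp
  exact le_antisymm (neg_nonneg.1 (S.nonneg_of_mem_cylinderIntegralGraph hneg le_rfl))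
    (S.nonneg_of_mem_cylinderIntegralGraph hp le_rfl)

theorem exists_nonneg_extension_cylinderIntegral [∀ i, (S.μ i).IsOpenPosMeasure] :
    ∃ L : C(S.Limit, ℝ) →ₗ[ℝ] ℝ, (∀ F, 0 ≤ F → 0 ≤ L F) ∧
      ∀ i f, L (S.pullback ℝ i f) = ∫ x, f x ∂S.μ i := by
  have hzero := fun p hp h => S.eq_zero_of_mem_cylinderIntegralGraph (p := p) hp h
  have hmem (i : I) (f : C(S.X i, ℝ)) :
      (S.pullback ℝ i f, ∫ x, f x ∂S.μ i) ∈ S.cylinderIntegralGraph := ⟨i, f, rfl, rfl⟩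
  obtain ⟨L, hL, hpos⟩ := riesz_extension (PointedCone.positive ℝ C(S.Limit, ℝ))
    S.cylinderIntegralGraph.toLinearPMap
    (fun F hF => S.nonneg_of_mem_cylinderIntegralGraph
      (Submodule.mem_graph_toLinearPMap hzero F) hF)
    (fun F => by
      have i := Classical.arbitrary I
      refine ⟨⟨_, _, hmem i (algebraMap ℝ _ ‖F‖), rfl⟩, fun a => ?_⟩
      have hFa := abs_le.1 (F.norm_coe_le_norm a)
      have hconst : S.pullback ℝ i (algebraMap ℝ _ ‖F‖) a = ‖F‖ := rfl
      change 0 ≤ S.pullback ℝ i (algebraMap ℝ _ ‖F‖) a + F a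
      linarith [hFa.1])
  refine ⟨L, hpos, fun i f => (hL ⟨_, _, hmem i f, rfl⟩).trans ?_⟩
  have hdiff := sub_mem (Submodule.mem_graph_toLinearPMap hzero ⟨_, _, hmem i f, rfl⟩) (hmem i f)
  exact sub_eq_zero.1 (hzero _ hdiff (sub_self _))

theorem exists_limit_measure [∀ i, (S.μ i).IsOpenPosMeasure] [∀ i, (S.μ i).Regular] :
    ∃ μ : Measure S.Limit, μ.Regular ∧ ∀ i, MeasurePreserving (S.proj i) μ (S.μ i) := by
  obtain ⟨L, hpos, hL⟩ := S.exists_nonneg_extension_cylinderIntegral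
  obtain ⟨μ, hμ, hμL⟩ := exists_regular_integral_eq_of_nonneg L hpos
  refine ⟨μ, hμ, fun i => ⟨(S.continuous_proj i).measurable, ?_⟩⟩
  have := regular_map_of_continuous (μ := μ) (S.continuous_proj i)
  refine measure_ext_of_integral_continuousMap fun f => ?_
  rw [integral_map (S.continuous_proj i).aemeasurable f.continuous.aestronglyMeasurable]
  exact (hμL (S.pullback ℝ i f)).trans (hL i f)

end Existence

theorem limit_measure_unique {μ ν : Measure S.Limit} [μ.Regular] [ν.Regular]
    (hμ : ∀ i, MeasurePreserving (S.proj i) μ (S.μ i))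
    (hν : ∀ i, MeasurePreserving (S.proj i) ν (S.μ i)) : ν = μ := by
  have heq : (fun F : C(S.Limit, ℝ) => ∫ a, F a ∂ν) = fun F => ∫ a, F a ∂μ := by
    refine (continuous_integral_continuousMap ν).ext_on (S.dense_cylinder ℝ)
      (continuous_integral_continuousMap μ) ?_
    rintro _ ⟨i, f, rfl⟩
    exact (S.integral_pullback (hν i) f).trans (S.integral_pullback (hμ i) f).symm
  exact measure_ext_of_integral_continuousMap (congrFun heq)

theorem isOpenPosMeasure_limit [∀ i, (S.μ i).IsOpenPosMeasure] {μ : Measure S.Limit}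
    (hμ : ∀ i, MeasurePreserving (S.proj i) μ (S.μ i)) : μ.IsOpenPosMeasure := by
  refine ⟨fun U hU ⟨a, ha⟩ hnull => ?_⟩
  obtain ⟨i, V, hV, haV, hVU⟩ := S.exists_preimage_proj_subset (hU.mem_nhds ha)
  refine hV.measure_ne_zero (S.μ i) ⟨_, haV⟩ ?_
  rw [← (hμ i).measure_preimage hV.measurableSet.nullMeasurableSet]
  exact measure_mono_null hVU hnull

end MeasInvSystem

/-! ### Representations that determine the norm -/

theorem generatedCStar_coe {A : Type u} [NonUnitalCStarAlgebra A]
    (B : NonUnitalStarSubalgebra ℂ A) : generatedCStar (B : Set A) = B.topologicalClosure := by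
  rw [generatedCStar, NonUnitalStarAlgebra.adjoin_eq]

open scoped CStarAlgebra in
theorem exists_starAlgEquiv_generatedCStar {A : Type u} {C : Type v} [NonUnitalCStarAlgebra A]
    [NonUnitalCStarAlgebra C] (B : NonUnitalStarSubalgebra ℂ A) (π : A →⋆ₙₐ[ℂ] C)
    (K : NonUnitalStarSubalgebra ℂ C) (hB : ∀ x ∈ B, ‖x‖ ≤ ‖π x‖)
    (hK : closure (π '' B) = (K : Set C)) :
    ∃ e : generatedCStar (B : Set A) ≃⋆ₐ[ℂ] K, ∀ x, (e x : C) = π x := by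
  have hπ : Continuous π := map_continuous π
  have mem_closure (x : generatedCStar (B : Set A)) : (x : A) ∈ closure (B : Set A) :=
    (generatedCStar_coe B).le x.2
  have map_mem (x : generatedCStar (B : Set A)) : π x ∈ K :=
    hK.le (map_mem_closure hπ (mem_closure x) fun y hy => ⟨y, hy, rfl⟩)
  have norm_map (x : generatedCStar (B : Set A)) : ‖π x‖ = ‖(x : A)‖ :=
    le_antisymm (NonUnitalStarAlgHom.norm_apply_le π x.1)
      (closure_minimal hB (isClosed_le continuous_norm hπ.norm) (mem_closure x))
  let f : generatedCStar (B : Set A) →⋆ₙₐ[ℂ] K :=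
    NonUnitalStarAlgHom.codRestrict
      (π.comp (NonUnitalStarSubalgebraClass.subtype (generatedCStar (B : Set A)))) K map_mem
  have hf : Isometry f := AddMonoidHomClass.isometry_of_norm f norm_map
  have hsurj : Function.Surjective f := by
    intro y
    rw [← Set.mem_range, ← hf.isClosedEmbedding.isClosed_range.closure_eq, closure_subtype]
    refine closure_mono ?_ (hK.ge y.2)
    rintro _ ⟨x, hx, rfl⟩
    exact ⟨_, ⟨⟨x, mem_generatedCStar hx⟩, rfl⟩, rfl⟩
  exact ⟨StarAlgEquiv.ofBijective f ⟨hf.injective, hsurj⟩, fun _ => rfl⟩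

namespace BlockOps

variable {ι : Type u} {H : ι → Type v} [∀ i, NormedAddCommGroup (H i)]
  [∀ i, InnerProductSpace ℂ (H i)] [∀ i, CompleteSpace (H i)]

variable (H) in
/-- The projection of a product of algebras of operators to one of its factors. -/
def eval (i : ι) : BlockOps H →⋆ₙₐ[ℂ] (H i →L[ℂ] H i) where
  toFun x := x.1 i
  map_smul' _ _ := rfl
  map_zero' := rfl
  map_add' _ _ := rfl
  map_mul' _ _ := rfl
  map_star' _ := rfl

theorem ext {x y : BlockOps H} (h : ∀ i, eval H i x = eval H i y) : x = y :=
  Subtype.ext (funext h)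

theorem norm_le {x : BlockOps H} {C : ℝ} (hC : 0 ≤ C) (h : ∀ i, ‖eval H i x‖ ≤ C) : ‖x‖ ≤ C :=
  lp.norm_le_of_forall_le hC h

end BlockOps

section DirectLimit

variable {I : Type u} [Preorder I] {A : I → Type v}
  [∀ i, NonUnitalCStarAlgebra (A i)] (φ : ∀ ⦃i j : I⦄, i ≤ j → A i →⋆ₙₐ[ℂ] A j)

theorem universalImage_connect {i j : I} (h : i ≤ j) (a : A i) :
    universalImage φ j (φ h a) = universalImage φ i a :=
  BlockOps.ext fun ρ => ρ.compatible h a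

variable [IsDirectedOrder I]

theorem exists_common_universalImage {i j : I} (a : A i) (b : A j) : ∃ (k : I) (a' b' : A k),
    universalImage φ k a' = universalImage φ i a ∧
      universalImage φ k b' = universalImage φ j b := by
  obtain ⟨k, hik, hjk⟩ := exists_ge_ge i j
  exact ⟨k, φ hik a, φ hjk b, universalImage_connect φ hik a, universalImage_connect φ hjk b⟩

variable [Nonempty I]

/-- The union of the images of the members of a direct system of C⋆-algebras in the universal
representation of the system, a dense ⋆-subalgebra of the direct limit. -/
def universalImages : NonUnitalStarSubalgebra ℂ (BlockOps fun ρ : SystemRep φ => ρ.H) where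
  carrier := {x | ∃ (i : I) (a : A i), universalImage φ i a = x}
  add_mem' := by
    rintro _ _ ⟨i, a, rfl⟩ ⟨j, b, rfl⟩
    obtain ⟨k, a', b', ha, hb⟩ := exists_common_universalImage φ a b
    exact ⟨k, a' + b', by rw [← ha, ← hb]; exact BlockOps.ext fun ρ => map_add (ρ.rep k) a' b'⟩
  mul_mem' := by
    rintro _ _ ⟨i, a, rfl⟩ ⟨j, b, rfl⟩
    obtain ⟨k, a', b', ha, hb⟩ := exists_common_universalImage φ a b
    exact ⟨k, a' * b', by rw [← ha, ← hb]; exact BlockOps.ext fun ρ => map_mul (ρ.rep k) a' b'⟩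
  zero_mem' := ⟨Classical.arbitrary I, 0, BlockOps.ext fun ρ => map_zero (ρ.rep _)⟩
  smul_mem' := by
    rintro c _ ⟨i, a, rfl⟩
    exact ⟨i, c • a, BlockOps.ext fun ρ => map_smul (ρ.rep i) c a⟩
  star_mem' := by
    rintro _ ⟨i, a, rfl⟩
    exact ⟨i, star a, BlockOps.ext fun ρ => map_star (ρ.rep i) a⟩

theorem CStarDirectLimit.exists_starAlgEquiv (ρ : SystemRep φ)
    (K : NonUnitalStarSubalgebra ℂ (ρ.H →L[ℂ] ρ.H)) (hρ : ∀ i a, ‖a‖ ≤ ‖ρ.rep i a‖)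
    (hK : closure (⋃ i, Set.range (ρ.rep i)) = (K : Set (ρ.H →L[ℂ] ρ.H))) :
    ∃ Ψ : CStarDirectLimit φ ≃⋆ₐ[ℂ] K,
      ∀ i a, (Ψ (CStarDirectLimit.of φ i a) : ρ.H →L[ℂ] ρ.H) = ρ.rep i a := by
  have norm_le_eval : ∀ x ∈ universalImages φ,
      ‖x‖ ≤ ‖BlockOps.eval (fun ρ : SystemRep φ => ρ.H) ρ x‖ := by
    rintro _ ⟨i, a, rfl⟩
    exact BlockOps.norm_le (norm_nonneg _) fun σ =>
      (NonUnitalStarAlgHom.norm_apply_le (σ.rep i) a).trans (hρ i a)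
  have image_eval : BlockOps.eval (fun ρ : SystemRep φ => ρ.H) ρ '' universalImages φ =
      ⋃ i, Set.range (ρ.rep i) := by
    ext T
    simp only [Set.mem_image, Set.mem_iUnion, Set.mem_range]
    constructor
    · rintro ⟨_, ⟨i, a, rfl⟩, rfl⟩
      exact ⟨i, a, rfl⟩
    · rintro ⟨i, a, rfl⟩
      exact ⟨_, ⟨i, a, rfl⟩, rfl⟩
  obtain ⟨e, he⟩ := exists_starAlgEquiv_generatedCStar (universalImages φ)
    (BlockOps.eval (fun ρ : SystemRep φ => ρ.H) ρ) K norm_le_eval (image_eval ▸ hK)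
  exact ⟨e, fun i a => he _⟩

end DirectLimit

/-! ### Compact operators -/

theorem tendsto_comp_of_isCompactOperator {𝕜 : Type*} [RCLike 𝕜] {E F G : Type*}
    [NormedAddCommGroup E] [NormedSpace 𝕜 E] [NormedAddCommGroup F] [NormedSpace 𝕜 F]
    [NormedAddCommGroup G] [NormedSpace 𝕜 G] {ι : Type*} {l : Filter ι} {P : ι → F →L[𝕜] G}
    {Q : F →L[𝕜] G} {C : NNReal} (hC : ∀ i, ‖P i‖₊ ≤ C)
    (hP : ∀ y, Tendsto (fun i => P i y) l (𝓝 (Q y))) {T : E →L[𝕜] F} (hT : IsCompactOperator T) :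
    Tendsto (fun i => P i ∘L T) l (𝓝 (Q ∘L T)) := by
  have hK : IsCompact (closure (T '' Metric.closedBall 0 1)) :=
    hT.isCompact_closure_image_closedBall 1
  have equicontinuous : UniformEquicontinuous fun i => ⇑(P i) :=
    LipschitzWith.uniformEquicontinuous _ C fun i => (P i).lipschitz.weaken (hC i)
  have uniform :
      TendstoUniformlyOn (fun i => ⇑(P i)) Q l (closure (T '' Metric.closedBall 0 1)) := by
    have h := (EquicontinuousOn.tendsto_uniformOnFun_iff_pi'
      (𝔖 := {closure (T '' Metric.closedBall 0 1)}) (by simpa using hK)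
      (fun _ _ => equicontinuous.equicontinuous.equicontinuousOn _) l Q).2
      (tendsto_pi_nhds.2 fun y => hP y)
    exact UniformOnFun.tendsto_iff_tendstoUniformlyOn.1 h _ rfl
  rw [Metric.tendsto_nhds]
  intro ε hε
  filter_upwards [Metric.tendstoUniformlyOn_iff.1 uniform (ε / 2) (half_pos hε)] with i hi
  rw [dist_eq_norm]
  refine (ContinuousLinearMap.opNorm_le_of_unit_norm (half_pos hε).le fun x hx => ?_).trans_lt
    (half_lt_self hε)
  rw [sub_apply, ← dist_eq_norm, dist_comm]
  exact (hi (T x) (subset_closure ⟨x, by simp [hx], rfl⟩)).le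

section RankOne

variable {𝕜 : Type*} [RCLike 𝕜] {H : Type*} [NormedAddCommGroup H] [InnerProductSpace 𝕜 H]
  [CompleteSpace H]

open InnerProductSpace in
theorem starProjection_comp_mem_of_rankOne_mem {R : Submodule 𝕜 (H →L[𝕜] H)}
    (hR : ∀ x y, rankOne 𝕜 x y ∈ R) (V : Submodule 𝕜 H) [FiniteDimensional 𝕜 V]
    (T : H →L[𝕜] H) : V.starProjection ∘L T ∈ R := by
  rw [(stdOrthonormalBasis 𝕜 V).starProjection_eq_sum_rankOne, ContinuousLinearMap.finsetSum_comp]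
  simp only [rankOne_comp]
  exact R.sum_mem fun _ _ => hR _ _

theorem mem_of_isCompactOperator_of_rankOne_mem {R : Submodule 𝕜 (H →L[𝕜] H)}
    (hcl : IsClosed (R : Set (H →L[𝕜] H))) (hR : ∀ x y, InnerProductSpace.rankOne 𝕜 x y ∈ R)
    {T : H →L[𝕜] H} (hT : IsCompactOperator T) : T ∈ R := by
  let V (t : Finset H) : Submodule 𝕜 H := Submodule.span 𝕜 (t : Set H)
  have hV : Monotone V := fun s t h => Submodule.span_mono (Finset.coe_subset.2 h)
  have hd : ⊤ ≤ (⨆ t, V t).topologicalClosure := fun y _ =>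
    Submodule.le_topologicalClosure _
      (Submodule.mem_iSup_of_mem {y} (Submodule.subset_span (by simp)))
  have hlim : Tendsto (fun t => (V t).starProjection ∘L T) atTop (𝓝 T) :=
    tendsto_comp_of_isCompactOperator (C := 1) (fun t => (V t).starProjection_norm_le)
      (Q := ContinuousLinearMap.id 𝕜 H)
      (fun y => Submodule.starProjection_tendsto_self V hV y hd) hT
  exact hcl.mem_of_tendsto hlim
    (Eventually.of_forall fun t => starProjection_comp_mem_of_rankOne_mem hR (V t) T)

end RankOne

theorem tendsto_mul_mul_of_isCompactOperator {H : Type*} [NormedAddCommGroup H]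
    [InnerProductSpace ℂ H] [CompleteSpace H] {ι : Type*} {l : Filter ι} {P : ι → H →L[ℂ] H}
    (hsa : ∀ i, IsSelfAdjoint (P i)) (hP : ∀ i, ‖P i‖ ≤ 1)
    (hlim : ∀ y, Tendsto (fun i => P i y) l (𝓝 y)) {T : H →L[ℂ] H} (hT : IsCompactOperator T) :
    Tendsto (fun i => P i * T * P i) l (𝓝 T) := by
  have left {S : H →L[ℂ] H} (hS : IsCompactOperator S) : Tendsto (fun i => P i * S) l (𝓝 S) :=
    tendsto_comp_of_isCompactOperator (C := 1) hP (Q := ContinuousLinearMap.id ℂ H) hlim hS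
  have right : Tendsto (fun i => T * P i) l (𝓝 T) := by
    simpa only [star_mul, star_star, (hsa _).star_eq] using (left hT.star_clm).star
  have hzero : Tendsto (fun i => P i * (T * P i - T)) l (𝓝 0) := by
    refine squeeze_zero_norm (fun i => ?_) (tendsto_iff_norm_sub_tendsto_zero.1 right)
    exact (norm_mul_le _ _).trans (mul_le_of_le_one_left (norm_nonneg _) (hP i))
  simpa only [mul_sub, mul_assoc, add_sub_cancel, add_zero] using (left hT).add hzero

section Isometry

variable {H : Type*} [NormedAddCommGroup H] [InnerProductSpace ℂ H] [CompleteSpace H]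
  {K : Type*} [NormedAddCommGroup K] [InnerProductSpace ℂ K] [CompleteSpace K]

theorem adjoint_isometry_apply (u : H →ₗᵢ[ℂ] K) (x : H) :
    u.toContinuousLinearMap.adjoint (u x) = x :=
  DFunLike.congr_fun u.adjoint_comp_self x

theorem norm_conjOp (u : H →ₗᵢ[ℂ] K) (T : H →L[ℂ] H) : ‖conjOp u T‖ = ‖T‖ := by
  apply le_antisymm
  · have hadj : ‖u.toContinuousLinearMap.adjoint‖ ≤ 1 := by
      rw [LinearIsometryEquiv.norm_map]
      exact u.norm_toContinuousLinearMap_le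
    refine ContinuousLinearMap.opNorm_le_bound _ (norm_nonneg _) fun y => ?_
    rw [conjOp_apply, u.norm_map]
    exact T.le_opNorm_of_le (by simpa using ContinuousLinearMap.le_of_opNorm_le _ hadj y)
  · refine ContinuousLinearMap.opNorm_le_bound _ (norm_nonneg _) fun x => ?_
    have h := (conjOp u T).le_opNorm (u x)
    rwa [conjOp_apply, adjoint_isometry_apply, u.norm_map, u.norm_map] at h

theorem conjOp_one (u : H →ₗᵢ[ℂ] K) [u.toLinearMap.range.HasOrthogonalProjection] :
    conjOp u 1 = u.toLinearMap.range.starProjection := by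
  ext y
  refine (Submodule.eq_starProjection_of_mem_of_inner_eq_zero
    (LinearMap.mem_range_self u.toLinearMap (u.toContinuousLinearMap.adjoint y)) ?_).symm
  rintro _ ⟨x, rfl⟩
  have h := ContinuousLinearMap.adjoint_inner_left u.toContinuousLinearMap x
    (y - u (u.toContinuousLinearMap.adjoint y))
  simpa [adjoint_isometry_apply] using h.symm

end Isometry

section IsometricSystem

variable {I : Type u} [Preorder I] {F : I → Type v} [∀ i, NormedAddCommGroup (F i)]
  [∀ i, InnerProductSpace ℂ (F i)] [∀ i, CompleteSpace (F i)]
  {V : ∀ ⦃i j : I⦄, i ≤ j → F i →ₗᵢ[ℂ] F j}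

section

variable {K : Type w} [NormedAddCommGroup K] [InnerProductSpace ℂ K] [CompleteSpace K]
  {U : ∀ i, F i →ₗᵢ[ℂ] K} (hUV : ∀ ⦃i j : I⦄ (h : i ≤ j) (x : F i), U j (V h x) = U i x)

include hUV

theorem CompactOps.conj_conj {i j : I} (h : i ≤ j) (b : CompactOps (F i)) :
    CompactOps.conj (U j) (CompactOps.conj (V h) b) = CompactOps.conj (U i) b := by
  have hcomp : (U j).toContinuousLinearMap ∘L (V h).toContinuousLinearMap =
      (U i).toContinuousLinearMap := ContinuousLinearMap.ext (hUV h)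
  refine Subtype.ext ?_
  change conjOp _ (conjOp _ b.1) = conjOp _ b.1
  unfold conjOp
  rw [← hcomp, ContinuousLinearMap.adjoint_comp]
  rfl

variable (hd : Dense (⋃ i, Set.range (U i)))

include hd

theorem tendsto_conjOp_one (y : K) : Tendsto (fun i => conjOp (U i) 1 y) atTop (𝓝 y) := by
  have complete_range (i : I) : CompleteSpace (U i).toLinearMap.range :=
    (U i).isometry.isUniformInducing.isComplete_range.completeSpace_coe
  have mono : Monotone fun i => (U i).toLinearMap.range := by
    rintro i j h _ ⟨x, rfl⟩
    exact ⟨V h x, hUV h x⟩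
  have dense : ⊤ ≤ (⨆ i, (U i).toLinearMap.range).topologicalClosure := by
    intro y _
    refine closure_mono (Set.iUnion_subset fun i => ?_) (hd y)
    exact SetLike.coe_subset_coe.2 (le_iSup (fun i => (U i).toLinearMap.range) i)
  simpa only [conjOp_one] using Submodule.starProjection_tendsto_self _ mono y dense

theorem closure_iUnion_range_conj [IsDirectedOrder I] [Nonempty I] :
    closure (⋃ i, Set.range fun b => (CompactOps.conj (U i) b : K →L[ℂ] K)) = CompactOps K := by
  refine Set.Subset.antisymm (closure_minimal (Set.iUnion_subset fun i => ?_)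
    isClosed_setOfPred_isCompactOperator) fun T hT => ?_
  · rintro _ ⟨b, rfl⟩
    exact (CompactOps.conj (U i) b).2
  have hsa (i : I) : IsSelfAdjoint (conjOp (U i) 1) := by
    rw [IsSelfAdjoint, ← conjOp_star, star_one]
  have hnorm (i : I) : ‖conjOp (U i) 1‖ ≤ 1 := by
    rw [norm_conjOp]
    exact ContinuousLinearMap.norm_id_le
  have hlim : Tendsto (fun i => conjOp (U i) 1 * T * conjOp (U i) 1) atTop (𝓝 T) :=
    tendsto_mul_mul_of_isCompactOperator hsa hnorm (tendsto_conjOp_one hUV hd) hT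
  refine mem_closure_of_tendsto hlim (Eventually.of_forall fun i => Set.mem_iUnion.2 ⟨i, ?_⟩)
  have hcompact : (U i).toContinuousLinearMap.adjoint ∘L T ∘L (U i).toContinuousLinearMap ∈
      CompactOps (F i) :=
    (hT.comp_clm (U i).toContinuousLinearMap).clm_comp (U i).toContinuousLinearMap.adjoint
  exact ⟨⟨_, hcompact⟩, rfl⟩

end

variable {K : Type (max u v)} [NormedAddCommGroup K] [InnerProductSpace ℂ K] [CompleteSpace K]
  {U : ∀ i, F i →ₗᵢ[ℂ] K} (hUV : ∀ ⦃i j : I⦄ (h : i ≤ j) (x : F i), U j (V h x) = U i x)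

/-- The representation by conjugation, on the limit Hilbert space, of the system of the algebras of
compact operators of a direct system of Hilbert spaces and isometries. -/
noncomputable def conjRep : SystemRep fun _ _ h => CompactOps.conj (V h) where
  H := K
  rep i := (NonUnitalStarSubalgebraClass.subtype (CompactOps K)).comp (CompactOps.conj (U i))
  compatible _ _ h b := congrArg Subtype.val (CompactOps.conj_conj hUV h b)

include hUV in
theorem exists_starAlgEquiv_compactOps [IsDirectedOrder I] [Nonempty I]
    (hd : Dense (⋃ i, Set.range (U i))) :
    ∃ Ψ : CStarDirectLimit (fun _ _ h => CompactOps.conj (V h)) ≃⋆ₐ[ℂ] CompactOps K,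
      ∀ (i : I) (b : CompactOps (F i)),
        Ψ (CStarDirectLimit.of (fun _ _ h => CompactOps.conj (V h)) i b) =
          CompactOps.conj (U i) b := by
  obtain ⟨Ψ, hΨ⟩ := CStarDirectLimit.exists_starAlgEquiv _ (conjRep hUV) (CompactOps K)
    (fun i b => (norm_conjOp (U i) b.1).ge) (closure_iUnion_range_conj hUV hd)
  exact ⟨Ψ, fun i b => Subtype.ext (hΨ i b)⟩

end IsometricSystem

/-! ### Integral operators with continuous kernels -/

theorem continuous_rankOne {𝕜 : Type*} [RCLike 𝕜] {H : Type*} [NormedAddCommGroup H]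
    [InnerProductSpace 𝕜 H] : Continuous fun p : H × H => InnerProductSpace.rankOne 𝕜 p.1 p.2 :=
  ((ContinuousLinearMap.smulRightL 𝕜 H H).continuous.comp
    ((innerSL 𝕜).continuous.comp continuous_snd)).clm_apply continuous_fst

section IntegralOperator

variable {X : Type u} [TopologicalSpace X]

/-- The continuous function `y ↦ h (y, x)`. -/
noncomputable def kernelRow (h : C(X × X, ℂ)) (x : X) : C(X, ℂ) :=
  (h.comp ContinuousMap.prodSwap).curry x

theorem continuous_kernelRow (h : C(X × X, ℂ)) : Continuous (kernelRow h) :=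
  (h.comp ContinuousMap.prodSwap).curry.continuous

variable [CompactSpace X]

theorem norm_curry_le (h : C(X × X, ℂ)) (x : X) : ‖h.curry x‖ ≤ ‖h‖ :=
  (ContinuousMap.norm_le _ (norm_nonneg _)).2 fun y => h.norm_coe_le_norm (x, y)

theorem norm_kernelRow_le (h : C(X × X, ℂ)) (x : X) : ‖kernelRow h x‖ ≤ ‖h‖ :=
  (ContinuousMap.norm_le _ (norm_nonneg _)).2 fun y => h.norm_coe_le_norm (y, x)

variable [MeasurableSpace X] [BorelSpace X] (μ : Measure X) [IsFiniteMeasure μ]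

/-- The canonical map of the continuous functions to `L²`. -/
noncomputable abbrev toL2 : C(X, ℂ) →L[ℂ] Lp ℂ 2 μ := ContinuousMap.toLp 2 μ ℂ

/-- The operator taking `ψ ∈ L²` to the continuous function `x ↦ ∫ h (y, x) ψ y`, as a function of
its kernel `h`. The integral is written as an inner product, so that continuity in `x` is that of
`kernelRow h`. -/
noncomputable def kernelFun : C(X × X, ℂ) →L[ℂ] Lp ℂ 2 μ →L[ℂ] C(X, ℂ) :=
  LinearMap.mkContinuous₂
    (LinearMap.mk₂ ℂ
      (fun h ψ => ⟨fun x => inner ℂ (toL2 μ (star (kernelRow h x))) ψ,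
        ((toL2 μ).continuous.comp (continuous_kernelRow h).star).inner continuous_const⟩)
      (fun h k ψ => ContinuousMap.ext fun x => by
        change inner ℂ (toL2 μ (star (kernelRow h x + kernelRow k x))) ψ = _
        rw [star_add, map_add, inner_add_left]
        rfl)
      (fun c h ψ => ContinuousMap.ext fun x => by
        change inner ℂ (toL2 μ (star (c • kernelRow h x))) ψ = _
        rw [star_smul, map_smul, inner_smul_left]
        simp)
      (fun h ψ χ => ContinuousMap.ext fun x =>
        inner_add_right (toL2 μ (star (kernelRow h x))) ψ χ)
      (fun c h ψ => ContinuousMap.ext fun x =>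
        inner_smul_right (toL2 μ (star (kernelRow h x))) ψ c))
    ‖toL2 μ‖ fun h ψ => (ContinuousMap.norm_le _ (by positivity)).2 fun x =>
      (norm_inner_le_norm _ _).trans (mul_le_mul_of_nonneg_right
        ((toL2 μ).le_opNorm_of_le ((norm_star _).trans_le (norm_kernelRow_le h x)))
        (norm_nonneg _))

theorem kernelFun_apply (h : C(X × X, ℂ)) (ψ : Lp ℂ 2 μ) (x : X) :
    kernelFun μ h ψ x = inner ℂ (toL2 μ (star (kernelRow h x))) ψ := rfl

theorem kernelFun_apply_eq_integral (h : C(X × X, ℂ)) (ψ : Lp ℂ 2 μ) (x : X) :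
    kernelFun μ h ψ x = ∫ y, h (y, x) * ψ y ∂μ := by
  rw [kernelFun_apply, L2.inner_def]
  refine integral_congr_ae ?_
  filter_upwards [ContinuousMap.coeFn_toLp (p := 2) (𝕜 := ℂ) μ (star (kernelRow h x))] with y hy
  rw [hy]
  simp [kernelRow, mul_comm]

theorem kernelFun_toL2_apply (h : C(X × X, ℂ)) (f : C(X, ℂ)) (x : X) :
    kernelFun μ h (toL2 μ f) x = ∫ y, h (y, x) * f y ∂μ := by
  rw [kernelFun_apply_eq_integral]
  refine integral_congr_ae ?_
  filter_upwards [ContinuousMap.coeFn_toLp (p := 2) (𝕜 := ℂ) μ f] with y hy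
  rw [hy]

theorem isCompactOperator_kernelFun (h : C(X × X, ℂ)) : IsCompactOperator (kernelFun μ h) := by
  let e := ContinuousMap.isometryEquivBoundedOfCompact X ℂ
  let ball := Metric.closedBall (0 : Lp ℂ 2 μ) 1
  let A : Set (BoundedContinuousFunction X ℂ) := e '' (kernelFun μ h '' ball)
  have bounded (f : BoundedContinuousFunction X ℂ) (x : X) (hf : f ∈ A) :
      f x ∈ Metric.closedBall (0 : ℂ) ‖kernelFun μ h‖ := by
    obtain ⟨_, ⟨ψ, hψ, rfl⟩, rfl⟩ := hf
    rw [mem_closedBall_zero_iff] at hψ ⊢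
    exact ((kernelFun μ h ψ).norm_coe_le_norm x).trans
      (ContinuousLinearMap.unit_le_opNorm _ ψ hψ)
  have equicontinuous : Equicontinuous ((↑) : A → X → ℂ) := by
    intro x
    rw [Metric.equicontinuousAt_iff_right]
    intro ε hε
    have hrow : Continuous fun x => toL2 μ (star (kernelRow h x)) :=
      (toL2 μ).continuous.comp (continuous_kernelRow h).star
    filter_upwards [hrow.tendsto x (Metric.ball_mem_nhds _ hε)] with z hz
    rintro ⟨_, _, ⟨ψ, hψ, rfl⟩, rfl⟩
    rw [mem_closedBall_zero_iff] at hψ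
    change dist (kernelFun μ h ψ x) (kernelFun μ h ψ z) < ε
    rw [dist_comm, dist_eq_norm, kernelFun_apply, kernelFun_apply, ← inner_sub_left]
    refine (norm_inner_le_norm _ _).trans_lt ?_
    exact (mul_le_of_le_one_right (norm_nonneg _) hψ).trans_lt (mem_ball_iff_norm.1 hz)
  have compact_closure : IsCompact (closure A) :=
    BoundedContinuousFunction.arzela_ascoli _ (isCompact_closedBall 0 _) A bounded equicontinuous
  refine (isCompactOperator_iff_exists_mem_nhds_image_subset_compact _).2
    ⟨ball, Metric.closedBall_mem_nhds 0 one_pos, e.symm '' closure A,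
      compact_closure.image e.symm.continuous, ?_⟩
  intro f hf
  exact ⟨e f, subset_closure ⟨f, hf, rfl⟩, e.symm_apply_apply f⟩

/-- The integral operator `ψ ↦ ∫ h (y, ·) ψ y` on `L²`, as a function of its kernel `h`. -/
noncomputable def integralOp : C(X × X, ℂ) →L[ℂ] Lp ℂ 2 μ →L[ℂ] Lp ℂ 2 μ :=
  (ContinuousLinearMap.compL ℂ _ _ _ (toL2 μ)) ∘L kernelFun μ

theorem integralOp_apply (h : C(X × X, ℂ)) (ψ : Lp ℂ 2 μ) :
    integralOp μ h ψ = toL2 μ (kernelFun μ h ψ) := rfl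

theorem integralOp_apply_ae (h : C(X × X, ℂ)) (ψ : Lp ℂ 2 μ) :
    (integralOp μ h ψ : X → ℂ) =ᵐ[μ] fun x => ∫ y, h (y, x) * ψ y ∂μ := by
  filter_upwards [ContinuousMap.coeFn_toLp (p := 2) (𝕜 := ℂ) μ (kernelFun μ h ψ)] with x hx
  rw [integralOp_apply, hx, kernelFun_apply_eq_integral]

theorem isCompactOperator_integralOp (h : C(X × X, ℂ)) : IsCompactOperator (integralOp μ h) :=
  (isCompactOperator_kernelFun μ h).clm_comp (toL2 μ)

theorem inner_toL2_integralOp_toL2 (f : C(X × X, ℂ)) (φ ψ : C(X, ℂ)) :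
    inner ℂ (toL2 μ φ) (integralOp μ f (toL2 μ ψ)) =
      ∫ x, ∫ y, f (y, x) * ψ y * star (φ x) ∂μ ∂μ := by
  rw [integralOp_apply, ContinuousMap.inner_toLp]
  simp only [kernelFun_toL2_apply, ← integral_mul_const]
  rfl

theorem integralOp_star_tensor (φ ψ : C(X, ℂ)) :
    integralOp μ ⟨fun p => star (ψ p.1) * φ p.2, by fun_prop⟩ =
      InnerProductSpace.rankOne ℂ (toL2 μ φ) (toL2 μ ψ) := by
  ext1 χ
  rw [InnerProductSpace.rankOne_apply, integralOp_apply, ← map_smul]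
  congr 1
  ext x
  have hrow : star (kernelRow ⟨fun p : X × X => star (ψ p.1) * φ p.2, by fun_prop⟩ x) =
      star (φ x) • ψ := by
    ext y
    simp [kernelRow, mul_comm]
  rw [kernelFun_apply, hrow, map_smul, inner_smul_left]
  simp [mul_comm]

theorem curry_pairConv (f g : C(X × X, ℂ)) (z : X) :
    (pairConv μ f g).curry z = kernelFun μ f (toL2 μ (g.curry z)) := by
  ext x
  rw [kernelFun_toL2_apply]
  rfl

theorem star_kernelRow_pairConv (f g : C(X × X, ℂ)) (x : X) :
    star (kernelRow (pairConv μ f g) x) =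
      kernelFun μ (pairStar g) (toL2 μ (star (kernelRow f x))) := by
  ext z
  rw [kernelFun_toL2_apply]
  change star (∫ y, f (y, x) * g (z, y) ∂μ) = ∫ y, star (g (z, y)) * star (f (y, x)) ∂μ
  simp only [← star_mul]
  exact integral_conj.symm

variable [T2Space X] [μ.Regular]

theorem denseRange_toL2 : DenseRange (toL2 μ) :=
  ContinuousMap.toLp_denseRange ℂ μ ℂ (by norm_num)

theorem integralOp_pairStar (f : C(X × X, ℂ)) :
    integralOp μ (pairStar f) = star (integralOp μ f) := by
  rw [ContinuousLinearMap.star_eq_adjoint, ContinuousLinearMap.eq_adjoint_iff]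
  intro φ ψ
  refine (denseRange_toL2 μ).induction_on₂ (p := fun φ ψ =>
    inner ℂ (integralOp μ (pairStar f) φ) ψ = inner ℂ φ (integralOp μ f ψ))
    (isClosed_eq (by fun_prop) (by fun_prop)) (fun φ ψ => ?_) φ ψ
  have fubini : ∫ x, ∫ y, f (x, y) * ψ x * star (φ y) ∂μ ∂μ =
      ∫ y, ∫ x, f (x, y) * ψ x * star (φ y) ∂μ ∂μ :=
    integral_integral_swap_of_hasCompactSupport
      (f := fun x y => f (x, y) * ψ x * star (φ y)) (by fun_prop)
      (HasCompactSupport.of_compactSpace _)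
  rw [inner_toL2_integralOp_toL2, ← fubini, ← inner_conj_symm, inner_toL2_integralOp_toL2,
    ← integral_conj]
  refine integral_congr_ae (.of_forall fun x => integral_conj.symm.trans ?_)
  refine integral_congr_ae (.of_forall fun y => ?_)
  simp [pairStar]
  ring

theorem integralOp_pairConv (f g : C(X × X, ℂ)) :
    integralOp μ (pairConv μ f g) = integralOp μ f * integralOp μ g := by
  ext1 ψ
  refine congrArg (toL2 μ) (ContinuousMap.ext fun x => ?_)
  change kernelFun μ (pairConv μ f g) ψ x = kernelFun μ f (integralOp μ g ψ) x
  rw [kernelFun_apply, star_kernelRow_pairConv, ← integralOp_apply, integralOp_pairStar,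
    ContinuousLinearMap.star_eq_adjoint, ContinuousLinearMap.adjoint_inner_left]
  rfl

theorem closure_range_integralOp :
    closure (Set.range (integralOp μ)) = CompactOps (Lp ℂ 2 μ) := by
  refine Set.Subset.antisymm (closure_minimal ?_ isClosed_setOfPred_isCompactOperator)
    fun T hT => ?_
  · rintro _ ⟨f, rfl⟩
    exact isCompactOperator_integralOp μ f
  let R := (LinearMap.range (integralOp μ).toLinearMap).topologicalClosure
  have hcl : IsClosed (R : Set (Lp ℂ 2 μ →L[ℂ] Lp ℂ 2 μ)) := Submodule.isClosed_topologicalClosure _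
  have rankOne_mem (x y : Lp ℂ 2 μ) : InnerProductSpace.rankOne ℂ x y ∈ R := by
    refine (denseRange_toL2 μ).induction_on₂ (p := fun x y => InnerProductSpace.rankOne ℂ x y ∈ R)
      (hcl.preimage ?_) (fun φ ψ => ?_) x y
    · exact continuous_rankOne
    · exact Submodule.le_topologicalClosure _ ⟨_, integralOp_star_tensor μ φ ψ⟩
  exact mem_of_isCompactOperator_of_rankOne_mem hcl rankOne_mem hT

end IntegralOperator

/-! ### The C⋆-algebra of the pair groupoid -/

theorem norm_le_of_isSelfAdjoint_of_norm_pow_le {A : Type*} [NormedRing A] [StarRing A]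
    [CStarRing A] {a : A} (ha : IsSelfAdjoint a) {C r : ℝ} (hr : 0 ≤ r) {k : ℕ}
    (h : ∀ n, ‖a ^ (n + k)‖ ≤ C * r ^ n) : ‖a‖ ≤ r := by
  by_contra! hlt
  have hpos : 0 < ‖a‖ := hr.trans_lt hlt
  have hpow : Tendsto (fun n : ℕ => 2 ^ n) atTop atTop :=
    tendsto_pow_atTop_atTop_of_one_lt one_lt_two
  have hlim : Tendsto (fun n : ℕ => C * (r / ‖a‖) ^ (2 ^ n - k)) atTop (𝓝 (C * 0)) :=
    ((tendsto_pow_atTop_nhds_zero_of_lt_one (by positivity) ((div_lt_one hpos).2 hlt)).comp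
      ((tendsto_sub_atTop_nat k).comp hpow)).const_mul C
  have hbound : ∀ᶠ n in atTop, ‖a‖ ^ k ≤ C * (r / ‖a‖) ^ (2 ^ n - k) := by
    filter_upwards [hpow.eventually_ge_atTop k] with n hn
    rw [div_pow, ← mul_div_assoc, le_div_iff₀ (by positivity), ← pow_add, Nat.add_sub_cancel' hn,
      ← ha.norm_pow_two_pow]
    simpa only [Nat.sub_add_cancel hn] using h (2 ^ n - k)
  rw [mul_zero] at hlim
  exact (pow_pos hpos k).not_ge (ge_of_tendsto hlim hbound)

theorem norm_comp_le_norm_comp_swap_of_isSelfAdjoint {H E : Type*} [NormedAddCommGroup H]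
    [InnerProductSpace ℂ H] [CompleteSpace H] [NormedAddCommGroup E] [NormedSpace ℂ E]
    {J : E →L[ℂ] H} {K : H →L[ℂ] E} (h : IsSelfAdjoint (J ∘L K)) : ‖J ∘L K‖ ≤ ‖K ∘L J‖ := by
  have pow_comp (n : ℕ) : (J ∘L K) ^ (n + 1) = J ∘L ((K ∘L J) ^ n : E →L[ℂ] E) ∘L K := by
    induction n with
    | zero => rw [zero_add, pow_one, pow_zero]; rfl
    | succ n ih => rw [pow_succ, ih, pow_succ]; rfl
  refine norm_le_of_isSelfAdjoint_of_norm_pow_le h (norm_nonneg _) (k := 2)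
    (C := ‖J‖ * ‖K ∘L J‖ * ‖K‖) fun n => ?_
  rw [pow_comp]
  calc ‖J ∘L ((K ∘L J) ^ (n + 1) : E →L[ℂ] E) ∘L K‖
      ≤ ‖J‖ * (‖K ∘L J‖ ^ (n + 1) * ‖K‖) := by
        refine (ContinuousLinearMap.opNorm_comp_le _ _).trans ?_
        gcongr
        refine (ContinuousLinearMap.opNorm_comp_le _ _).trans ?_
        gcongr
        exact norm_pow_le' _ n.succ_pos
    _ = ‖J‖ * ‖K ∘L J‖ * ‖K‖ * ‖K ∘L J‖ ^ n := by ring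

section PairGroupoid

variable {X : Type u} [TopologicalSpace X] [MeasurableSpace X] (μ : Measure X)

theorem pairINorm_nonneg (f : C(X × X, ℂ)) : 0 ≤ pairINorm μ f :=
  le_max_of_le_left (Real.iSup_nonneg fun _ => integral_nonneg fun _ => norm_nonneg _)

theorem pairINorm_pairStar (f : C(X × X, ℂ)) : pairINorm μ (pairStar f) = pairINorm μ f := by
  simp only [pairINorm, pairStar, ContinuousMap.coe_mk, norm_star]
  exact max_comm _ _

variable [CompactSpace X] [IsFiniteMeasure μ]

theorem integral_norm_le_norm_mul (f : C(X, ℂ)) : ∫ y, ‖f y‖ ∂μ ≤ ‖f‖ * μ.real Set.univ :=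
  (le_abs_self _).trans (norm_integral_le_of_norm_le_const
    (.of_forall fun y => (norm_norm _).trans_le (f.norm_coe_le_norm y)))

theorem integral_norm_left_le_norm_mul (f : C(X × X, ℂ)) (x : X) :
    ∫ y, ‖f (y, x)‖ ∂μ ≤ ‖f‖ * μ.real Set.univ :=
  (integral_norm_le_norm_mul μ (kernelRow f x)).trans
    (mul_le_mul_of_nonneg_right (norm_kernelRow_le f x) measureReal_nonneg)

theorem integral_norm_right_le_norm_mul (f : C(X × X, ℂ)) (x : X) :
    ∫ y, ‖f (x, y)‖ ∂μ ≤ ‖f‖ * μ.real Set.univ :=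
  (integral_norm_le_norm_mul μ (f.curry x)).trans
    (mul_le_mul_of_nonneg_right (norm_curry_le f x) measureReal_nonneg)

theorem pairINorm_le_norm_mul (f : C(X × X, ℂ)) : pairINorm μ f ≤ ‖f‖ * μ.real Set.univ :=
  max_le (Real.iSup_le (integral_norm_right_le_norm_mul μ f) (by positivity))
    (Real.iSup_le (integral_norm_left_le_norm_mul μ f) (by positivity))

theorem integral_norm_left_le_pairINorm (f : C(X × X, ℂ)) (x : X) :
    ∫ y, ‖f (y, x)‖ ∂μ ≤ pairINorm μ f :=
  le_max_of_le_right (le_ciSup (f := fun x => ∫ y, ‖f (y, x)‖ ∂μ)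
    ⟨_, Set.forall_mem_range.2 (integral_norm_left_le_norm_mul μ f)⟩ x)

variable [BorelSpace X]

theorem norm_kernelFun_comp_toL2_le (f : C(X × X, ℂ)) :
    ‖kernelFun μ f ∘L toL2 μ‖ ≤ pairINorm μ f := by
  refine ContinuousLinearMap.opNorm_le_bound _ (pairINorm_nonneg μ f) fun φ => ?_
  refine (ContinuousMap.norm_le _ (mul_nonneg (pairINorm_nonneg μ f) (norm_nonneg φ))).2 fun x => ?_
  calc ‖kernelFun μ f (toL2 μ φ) x‖
      = ‖∫ y, f (y, x) * φ y ∂μ‖ := by rw [kernelFun_toL2_apply]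
    _ ≤ ∫ y, ‖f (y, x)‖ * ‖φ‖ ∂μ := by
        refine norm_integral_le_of_norm_le ?_ (.of_forall fun y => ?_)
        · exact (integrable_continuousMap μ (kernelRow f x)).norm.mul_const _
        · rw [norm_mul]
          gcongr
          exact φ.norm_coe_le_norm y
    _ ≤ pairINorm μ f * ‖φ‖ := by
        rw [integral_mul_const]
        gcongr
        exact integral_norm_left_le_pairINorm μ f x

variable {μ}

theorem PairRep.rep_iterate_pairConv (ρ : PairRep μ) (g f : C(X × X, ℂ)) (n : ℕ) :
    ρ.rep ((pairConv μ g)^[n] f) = ρ.rep g ^ n * ρ.rep f := by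
  induction n with
  | zero => simp
  | succ n ih => rw [Function.iterate_succ_apply', ρ.map_conv, ih, pow_succ', mul_assoc]

variable (μ)

theorem toL2_curry_iterate_pairConv (g f : C(X × X, ℂ)) (n : ℕ) (z : X) :
    toL2 μ (((pairConv μ g)^[n] f).curry z) = (integralOp μ g ^ n) (toL2 μ (f.curry z)) := by
  induction n with
  | zero => simp
  | succ n ih =>
    rw [Function.iterate_succ_apply', curry_pairConv, ih, pow_succ', ← integralOp_apply]
    rfl

theorem norm_iterate_pairConv_le (g f : C(X × X, ℂ)) (n : ℕ) :
    ‖(pairConv μ g)^[n + 2] f‖ ≤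
      ‖kernelFun μ g‖ * (‖integralOp μ g‖ ^ (n + 1) * (‖toL2 μ‖ * ‖f‖)) := by
  refine (ContinuousMap.norm_le _ (by positivity)).2 fun ⟨z, x⟩ => ?_
  calc ‖(pairConv μ g)^[n + 2] f (z, x)‖
      = ‖kernelFun μ g ((integralOp μ g ^ (n + 1)) (toL2 μ (f.curry z))) x‖ := by
        rw [← toL2_curry_iterate_pairConv, ← curry_pairConv, Function.iterate_succ_apply']
        rfl
    _ ≤ ‖kernelFun μ g ((integralOp μ g ^ (n + 1)) (toL2 μ (f.curry z)))‖ :=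
        ContinuousMap.norm_coe_le_norm _ x
    _ ≤ ‖kernelFun μ g‖ * (‖integralOp μ g‖ ^ (n + 1) * (‖toL2 μ‖ * ‖f‖)) := by
        refine (kernelFun μ g).le_opNorm_of_le (ContinuousLinearMap.le_of_opNorm_le_of_le _
          (norm_pow_le' _ n.succ_pos) ((toL2 μ).le_opNorm_of_le (norm_curry_le f z)))

variable {μ}

theorem PairRep.norm_rep_le_of_isSelfAdjoint (ρ : PairRep μ) {g : C(X × X, ℂ)}
    (hg : IsSelfAdjoint (ρ.rep g)) : ‖ρ.rep g‖ ≤ ‖integralOp μ g‖ := by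
  refine norm_le_of_isSelfAdjoint_of_norm_pow_le hg (norm_nonneg _) (k := 3)
    (C := ‖kernelFun μ g‖ * ‖integralOp μ g‖ * ‖toL2 μ‖ * ‖g‖ * μ.real Set.univ) fun n => ?_
  calc ‖ρ.rep g ^ (n + 3)‖
      = ‖ρ.rep ((pairConv μ g)^[n + 2] g)‖ := by rw [ρ.rep_iterate_pairConv, ← pow_succ]
    _ ≤ ‖(pairConv μ g)^[n + 2] g‖ * μ.real Set.univ :=
        (ρ.norm_le _).trans (pairINorm_le_norm_mul μ _)
    _ ≤ ‖kernelFun μ g‖ * (‖integralOp μ g‖ ^ (n + 1) * (‖toL2 μ‖ * ‖g‖)) * μ.real Set.univ := by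
        gcongr
        exact norm_iterate_pairConv_le μ g g n
    _ = _ := by ring

variable [T2Space X] [μ.Regular]

theorem PairRep.norm_rep_le (ρ : PairRep μ) (f : C(X × X, ℂ)) : ‖ρ.rep f‖ ≤ ‖integralOp μ f‖ := by
  have hrep : ρ.rep (pairConv μ (pairStar f) f) = star (ρ.rep f) * ρ.rep f := by
    rw [ρ.map_conv, ρ.map_star]
  have h := ρ.norm_rep_le_of_isSelfAdjoint (hrep ▸ IsSelfAdjoint.star_mul_self (ρ.rep f))
  rw [hrep, integralOp_pairConv, integralOp_pairStar, CStarRing.norm_star_mul_self,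
    CStarRing.norm_star_mul_self (x := integralOp μ f)] at h
  exact (mul_self_le_mul_self_iff (norm_nonneg _) (norm_nonneg _)).2 h

variable (μ)

/-- The bound by the `I`-norm without the Schur test: `T_f⋆ T_f` factors through `C(X)`, and the
other composite of its factors is a product of two operators on `C(X)` bounded by `I`-norms. -/
theorem norm_integralOp_le (f : C(X × X, ℂ)) : ‖integralOp μ f‖ ≤ pairINorm μ f := by
  let K := kernelFun μ (pairStar f) ∘L integralOp μ f
  have factorization : star (integralOp μ f) * integralOp μ f = toL2 μ ∘L K := by
    rw [← integralOp_pairStar]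
    rfl
  have selfAdjoint : IsSelfAdjoint (toL2 μ ∘L K) := factorization ▸ IsSelfAdjoint.star_mul_self _
  refine (mul_self_le_mul_self_iff (norm_nonneg _) (pairINorm_nonneg μ f)).2 ?_
  calc ‖integralOp μ f‖ * ‖integralOp μ f‖
      = ‖toL2 μ ∘L K‖ := by
        rw [← factorization, CStarRing.norm_star_mul_self (x := integralOp μ f)]
    _ ≤ ‖(kernelFun μ (pairStar f) ∘L toL2 μ) ∘L (kernelFun μ f ∘L toL2 μ)‖ :=
        norm_comp_le_norm_comp_swap_of_isSelfAdjoint selfAdjoint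
    _ ≤ pairINorm μ (pairStar f) * pairINorm μ f :=
        (ContinuousLinearMap.opNorm_comp_le _ _).trans (mul_le_mul
          (norm_kernelFun_comp_toL2_le μ _) (norm_kernelFun_comp_toL2_le μ f) (norm_nonneg _)
          (pairINorm_nonneg μ _))
    _ = pairINorm μ f * pairINorm μ f := by rw [pairINorm_pairStar]

/-- The representation of the convolution algebra on `L²` by integral operators. -/
noncomputable def integralRep : PairRep μ where
  H := Lp ℂ 2 μ
  rep := (integralOp μ).toLinearMap
  map_conv := integralOp_pairConv μ
  map_star := integralOp_pairStar μ
  norm_le := norm_integralOp_le μ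

/-- The image of the convolution algebra in its universal representation. -/
def pairUniversalImages : NonUnitalStarSubalgebra ℂ (BlockOps fun ρ : PairRep μ => ρ.H) where
  carrier := Set.range (pairUniversalImage μ)
  add_mem' := by
    rintro _ _ ⟨f, rfl⟩ ⟨g, rfl⟩
    exact ⟨f + g, BlockOps.ext fun ρ => map_add ρ.rep f g⟩
  mul_mem' := by
    rintro _ _ ⟨f, rfl⟩ ⟨g, rfl⟩
    exact ⟨pairConv μ f g, BlockOps.ext fun ρ => ρ.map_conv f g⟩
  zero_mem' := ⟨0, BlockOps.ext fun ρ => map_zero ρ.rep⟩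
  smul_mem' := by
    rintro c _ ⟨f, rfl⟩
    exact ⟨c • f, BlockOps.ext fun ρ => map_smul ρ.rep c f⟩
  star_mem' := by
    rintro _ ⟨f, rfl⟩
    exact ⟨pairStar f, BlockOps.ext fun ρ => ρ.map_star f⟩

theorem PairGroupoidCStar.exists_starAlgEquiv :
    ∃ Θ : PairGroupoidCStar μ ≃⋆ₐ[ℂ] CompactOps (Lp ℂ 2 μ),
      ∀ f, (Θ (PairGroupoidCStar.of μ f) : Lp ℂ 2 μ →L[ℂ] Lp ℂ 2 μ) = integralOp μ f := by
  have norm_le (x) (hx : x ∈ pairUniversalImages μ) :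
      ‖x‖ ≤ ‖BlockOps.eval (fun ρ : PairRep μ => ρ.H) (integralRep μ) x‖ := by
    obtain ⟨f, rfl⟩ := hx
    exact BlockOps.norm_le (norm_nonneg _) fun ρ => ρ.norm_rep_le f
  obtain ⟨Θ, hΘ⟩ := exists_starAlgEquiv_generatedCStar (pairUniversalImages μ)
    (BlockOps.eval (fun ρ : PairRep μ => ρ.H) (integralRep μ)) (CompactOps (Lp ℂ 2 μ)) norm_le
    ((congrArg closure (Set.range_comp _ _).symm).trans (closure_range_integralOp μ))
  exact ⟨Θ, fun f => hΘ _⟩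

end PairGroupoid

/-! ### The limit algebra -/

namespace MeasInvSystem

section LimitIsometry

variable {I : Type u} [Preorder I] (S : MeasInvSystem.{u, v} I) {μ : Measure S.Limit}
  (hμ : ∀ i, MeasurePreserving (S.proj i) μ (S.μ i))

/-- The isometry `u_{i,∞} : ψ ↦ ψ ∘ R_{i,∞}` into the `L²` space of the inverse limit. -/
noncomputable def limitIsometry (i : I) : Lp ℂ 2 (S.μ i) →ₗᵢ[ℂ] Lp ℂ 2 μ :=
  Lp.compMeasurePreservingₗᵢ ℂ (S.proj i) (hμ i)

theorem coeFn_limitIsometry (i : I) (ψ : Lp ℂ 2 (S.μ i)) :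
    S.limitIsometry hμ i ψ =ᵐ[μ] ψ ∘ S.proj i :=
  Lp.coeFn_compMeasurePreserving ψ (hμ i)

theorem limitIsometry_isometry {i j : I} (h : i ≤ j) (ψ : Lp ℂ 2 (S.μ i)) :
    S.limitIsometry hμ j (S.isometry h ψ) = S.limitIsometry hμ i ψ := by
  have hproj : S.R h ∘ S.proj j = S.proj i := funext (S.R_proj h)
  have hψ : S.isometry h ψ =ᵐ[S.μ j] ψ ∘ S.R h :=
    Lp.coeFn_compMeasurePreserving ψ (S.measurePreserving_R h)
  have hψ' := (hμ j).quasiMeasurePreserving.ae_eq_comp hψ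
  rw [Function.comp_assoc, hproj] at hψ'
  exact Lp.ext ((S.coeFn_limitIsometry hμ j _).trans
    (hψ'.trans (S.coeFn_limitIsometry hμ i ψ).symm))

theorem limitIsometry_toL2 [IsFiniteMeasure μ] (i : I) [IsFiniteMeasure (S.μ i)]
    (f : C(S.X i, ℂ)) :
    S.limitIsometry hμ i (toL2 (S.μ i) f) = toL2 μ (S.pullback ℂ i f) := by
  have hf := (hμ i).quasiMeasurePreserving.ae_eq_comp
    (ContinuousMap.coeFn_toLp (p := 2) (𝕜 := ℂ) (S.μ i) f)
  exact Lp.ext ((S.coeFn_limitIsometry hμ i _).trans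
    (hf.trans (ContinuousMap.coeFn_toLp μ (S.pullback ℂ i f)).symm))

variable [IsDirectedOrder I] [Nonempty I] [∀ i, IsFiniteMeasure (S.μ i)] [μ.Regular]

theorem dense_iUnion_range_limitIsometry :
    Dense (⋃ i, Set.range (S.limitIsometry hμ i)) := by
  refine ((denseRange_toL2 μ).dense_image (toL2 μ).continuous (S.dense_cylinder ℂ)).mono ?_
  rintro _ ⟨_, ⟨i, f, rfl⟩, rfl⟩
  exact Set.mem_iUnion.2 ⟨i, toL2 (S.μ i) f, S.limitIsometry_toL2 hμ i f⟩

theorem exists_starAlgEquiv_limitObs :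
    ∃ Ψ : S.LimitObs ≃⋆ₐ[ℂ] CompactOps (Lp ℂ 2 μ), ∀ (i : I) (b : S.Obs i),
      Ψ (CStarDirectLimit.of S.connect i b) = CompactOps.conj (S.limitIsometry hμ i) b :=
  exists_starAlgEquiv_compactOps (fun _ _ h => S.limitIsometry_isometry hμ h)
    (S.dense_iUnion_range_limitIsometry hμ)

theorem exists_limit_isomorphisms :
    ∃ (Φ : PairGroupoidCStar μ ≃⋆ₐ[ℂ] S.LimitObs)
      (Ψ : S.LimitObs ≃⋆ₐ[ℂ] CompactOps (Lp ℂ 2 μ)),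
      (∀ (h : C(S.Limit × S.Limit, ℂ)) (ψ : Lp ℂ 2 μ),
        ((Ψ (Φ (PairGroupoidCStar.of μ h))).1 ψ : S.Limit → ℂ) =ᵐ[μ]
          fun x => ∫ y, h (y, x) * ψ y ∂μ) ∧
      ∀ (i : I) (b : S.Obs i), Ψ (CStarDirectLimit.of S.connect i b) =
        CompactOps.conj (S.limitIsometry hμ i) b := by
  choose Ψ hΨ using S.exists_starAlgEquiv_limitObs hμ
  choose Θ hΘ using PairGroupoidCStar.exists_starAlgEquiv μ
  refine ⟨Θ.trans Ψ.symm, Ψ, fun h ψ => ?_, hΨ⟩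
  have hcomp : Ψ (Θ.trans Ψ.symm (PairGroupoidCStar.of μ h)) = Θ (PairGroupoidCStar.of μ h) :=
    Ψ.apply_symm_apply _
  rw [hcomp, hΘ]
  exact integralOp_apply_ae μ h ψ

end LimitIsometry

end MeasInvSystem

namespace LatticeGraph

variable (G : Type v) [Group G] [TopologicalSpace G] [IsTopologicalGroup G] [CompactSpace G]
  [T2Space G]

section Haar

variable (Λ : LatticeGraph.{u})

instance : (haar G Λ).Regular := by
  unfold haar
  infer_instance

instance : (redHaar G Λ).Regular :=
  regular_map_of_continuous continuous_toRed

instance : (redHaar G Λ).IsOpenPosMeasure :=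
  continuous_toRed.isOpenPosMeasure_map Quotient.mk_surjective

end Haar

variable {I : Type u} [Preorder I] (Λ : I ⥤ LatticeGraph.{w}) (i : I)

instance : ((configSystem G Λ).μ i).Regular :=
  inferInstanceAs (haar G (Λ.obj i)).Regular

instance : ((configSystem G Λ).μ i).IsOpenPosMeasure :=
  inferInstanceAs (haar G (Λ.obj i)).IsOpenPosMeasure

instance : ((reducedSystem G Λ).μ i).Regular :=
  inferInstanceAs (redHaar G (Λ.obj i)).Regular

instance : ((reducedSystem G Λ).μ i).IsOpenPosMeasure :=
  inferInstanceAs (redHaar G (Λ.obj i)).IsOpenPosMeasure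

end LatticeGraph

theorem mainTheorem1_general {I : Type u} [Preorder I] [IsDirectedOrder I] [Nonempty I]
    (S : MeasInvSystem.{u, v} I) [∀ i, (S.μ i).Regular] [∀ i, (S.μ i).IsOpenPosMeasure] :
    ∃ (μ : Measure S.Limit) (_ : μ.Regular)
      (hμ : ∀ i, MeasurePreserving (S.proj i) μ (S.μ i)),
      (∀ ν : Measure S.Limit, ν.Regular →
        (∀ i, MeasurePreserving (S.proj i) ν (S.μ i)) → ν = μ) ∧
      μ.IsOpenPosMeasure ∧
      ∃ (Φ : PairGroupoidCStar μ ≃⋆ₐ[ℂ] S.LimitObs)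
        (Ψ : S.LimitObs ≃⋆ₐ[ℂ] CompactOps (Lp ℂ 2 μ)),
        (∀ (h : C(S.Limit × S.Limit, ℂ)) (ψ : Lp ℂ 2 μ),
          ((Ψ (Φ (PairGroupoidCStar.of μ h))).1 ψ : S.Limit → ℂ) =ᵐ[μ]
            fun x => ∫ y, h (y, x) * ψ y ∂μ) ∧
        ∀ (i : I) (b : S.Obs i), Ψ (CStarDirectLimit.of S.connect i b) =
          CompactOps.conj (Lp.compMeasurePreservingₗᵢ ℂ (S.proj i) (hμ i)) b := by
  choose μ hreg hμ using S.exists_limit_measure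
  exact ⟨μ, hreg, hμ, fun ν _ hν => S.limit_measure_unique hμ hν,
    S.isOpenPosMeasure_limit hμ, S.exists_limit_isomorphisms hμ⟩

theorem mainTheorem1 {I : Type u} [Preorder I] [IsDirectedOrder I] [Nonempty I]
    (G : Type v) [Group G] [TopologicalSpace G] [IsTopologicalGroup G] [CompactSpace G] [T2Space G]
    (Λ : I ⥤ LatticeGraph.{w}) (S : MeasInvSystem.{u, max v w} I)
    (hS : S = LatticeGraph.configSystem G Λ ∨ S = LatticeGraph.reducedSystem G Λ) :
    ∃ (μ : Measure S.Limit) (_ : μ.Regular)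
      (hμ : ∀ i, MeasurePreserving (S.proj i) μ (S.μ i)),
      (∀ ν : Measure S.Limit, ν.Regular →
        (∀ i, MeasurePreserving (S.proj i) ν (S.μ i)) → ν = μ) ∧
      μ.IsOpenPosMeasure ∧
      ∃ (Φ : PairGroupoidCStar μ ≃⋆ₐ[ℂ] S.LimitObs)
        (Ψ : S.LimitObs ≃⋆ₐ[ℂ] CompactOps (Lp ℂ 2 μ)),
        (∀ (h : C(S.Limit × S.Limit, ℂ)) (ψ : Lp ℂ 2 μ),
          ((Ψ (Φ (PairGroupoidCStar.of μ h))).1 ψ : S.Limit → ℂ) =ᵐ[μ]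
            fun x => ∫ y, h (y, x) * ψ y ∂μ) ∧
        ∀ (i : I) (b : S.Obs i), Ψ (CStarDirectLimit.of S.connect i b) =
          CompactOps.conj (Lp.compMeasurePreservingₗᵢ ℂ (S.proj i) (hμ i)) b := by
  obtain rfl | rfl := hS <;> exact mainTheorem1_general _
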